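/- Let $\Omega=(-1,1)^2$, let $B,C>0$ and $0<\epsilon<1/2$, and let $S_0$ be the space of real symmetric traceless $2\times2$ matrices with $|\mathbf P|^2=\operatorname{tr}(\mathbf P^2)$. For $t\in[-1,1]$ let $T_\epsilon(t)=(1+t)/\epsilon$ if $t\le -1+\epsilon$, $T_\epsilon(t)=1$ if $|t|\le 1-\epsilon$, and $T_\epsilon(t)=(1-t)/\epsilon$ if $t\ge 1-\epsilon$. Let $\mathbf P_{bc}:\partial\Omega\to S_0$ be $$\mathbf P_{bc}(\pm1,y)=\frac{B}{2C}\begin{pmatrix}-T_\epsilon(y)&0\\0&T_\epsilon(y)\end{pmatrix},\qquad \mathbf P_{bc}(x,\pm1)=\frac{B}{2C}\begin{pmatrix}T_\epsilon(x)&0\\0&-T_\epsilon(x)\end{pmatrix},$$ and let $\mathcal A=\{\mathbf P\in H^1(\Omega;S_0):\ \mathbf P=\mathbf P_{bc}\text{ on }\partial\Omega\text{ in the sense of traces}\}$. For $b\ge1$ and $\lambda\ge0$ consider the rescaled reduced Landau--de Gennes energy $$E[\mathbf P]=\int_\Omega\Big[\frac1{2b^2}|\mathbf P_x|^2+\frac12|\mathbf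 P_y|^2+\frac{\lambda^2}{2C}\Big(-\frac{B^2}{4C}|\mathbf P|^2+\frac C4|\mathbf P|^4\Big)\Big]\,dA .$$ A critical point of $E$ in $\mathcal A$ is a $\mathbf P\in\mathcal A$ with $\frac{d}{dt}E[\mathbf P+t\Phi]\big|_{t=0}=0$ for all $\Phi\in H^1_0(\Omega;S_0)$. Let the domain size $S=4\lambda^2b$ be fixed, and put $b_0=\max\left(1,\frac{SB^2}{C^2}\right)$. Then for every $b>b_0$, with $\lambda=\sqrt{S/(4b)}$, the energy $E$ has a unique critical point $\mathbf P$ in $\mathcal A$, and it satisfies $P_{12}\equiv0$. -/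

import Mathlib

open MeasureTheory Set Filter Topology

namespace RLdG

/-- The (open) rescaled domain, the square `(-1,1) × (-1,1)` in the `(x,y)`-plane. -/
def Omega : Set (ℝ × ℝ) := Ioo (-1) 1 ×ˢ Ioo (-1) 1

/-- Two-dimensional Lebesgue measure on the square. -/
noncomputable def muOmega : Measure (ℝ × ℝ) := volume.restrict Omega

instance : IsFiniteMeasure muOmega := by
  refine ⟨?_⟩
  rw [muOmega, Measure.restrict_apply_univ, Omega, Measure.volume_eq_prod, Measure.prod_prod]
  simp only [Real.volume_Ioo]
  exact ENNReal.mul_lt_top ENNReal.ofReal_lt_top ENNReal.ofReal_lt_top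

/-- The real Lebesgue space `L²(Ω)`. -/
noncomputable abbrev L2 : Type := Lp ℝ 2 muOmega

/-- Test functions: `C_c^∞(Ω)`. -/
def IsTest (φ : ℝ × ℝ → ℝ) : Prop :=
  ContDiff ℝ ((⊤ : ℕ∞) : WithTop ℕ∞) φ ∧ HasCompactSupport φ ∧ tsupport φ ⊆ Omega

/-- `v` is the weak derivative of `u` on `Ω` in the direction `e`. -/
def IsWeakDeriv (e : ℝ × ℝ) (u v : L2) : Prop :=
  ∀ φ : ℝ × ℝ → ℝ, IsTest φ →
    ∫ z, u z * fderiv ℝ φ z e ∂muOmega = -∫ z, v z * φ z ∂muOmega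

theorem L2.integrable_mul (u : L2) {ψ : ℝ × ℝ → ℝ} (hc : Continuous ψ)
    (hs : HasCompactSupport ψ) : Integrable (fun z => u z * ψ z) muOmega := by
  obtain ⟨K, hK⟩ := hc.bounded_above_of_compact_support hs
  have hu : Integrable (fun z => u z) muOmega := (Lp.memLp u).integrable (by norm_num)
  exact hu.mul_bdd (c := K) hc.aestronglyMeasurable (Eventually.of_forall hK)

theorem L2.integral_add_mul (u v : L2) {ψ : ℝ × ℝ → ℝ} (hc : Continuous ψ)
    (hs : HasCompactSupport ψ) :
    ∫ z, (u + v : L2) z * ψ z ∂muOmega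
      = ∫ z, u z * ψ z ∂muOmega + ∫ z, v z * ψ z ∂muOmega := by
  rw [← integral_add (u.integrable_mul hc hs) (v.integrable_mul hc hs)]
  refine integral_congr_ae ?_
  filter_upwards [Lp.coeFn_add u v] with z hz
  simp only [hz, Pi.add_apply]
  ring

theorem L2.integral_smul_mul (c : ℝ) (u : L2) (ψ : ℝ × ℝ → ℝ) :
    ∫ z, (c • u : L2) z * ψ z ∂muOmega = c * ∫ z, u z * ψ z ∂muOmega := by
  rw [← integral_const_mul]
  refine integral_congr_ae ?_
  filter_upwards [Lp.coeFn_smul c u] with z hz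
  simp only [hz, Pi.smul_apply, smul_eq_mul]
  ring

theorem IsTest.continuous_deriv {φ : ℝ × ℝ → ℝ} (h : IsTest φ) (e : ℝ × ℝ) :
    Continuous (fun z => fderiv ℝ φ z e) :=
  (h.1.continuous_fderiv (by simp)).clm_apply continuous_const

theorem IsTest.compact_deriv {φ : ℝ × ℝ → ℝ} (h : IsTest φ) (e : ℝ × ℝ) :
    HasCompactSupport (fun z => fderiv ℝ φ z e) := h.2.1.fderiv_apply ℝ e

theorem IsWeakDeriv.add {e : ℝ × ℝ} {u v u' v' : L2} (h : IsWeakDeriv e u v)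
    (h' : IsWeakDeriv e u' v') : IsWeakDeriv e (u + u') (v + v') := by
  intro φ hφ
  rw [L2.integral_add_mul u u' (hφ.continuous_deriv e) (hφ.compact_deriv e),
    L2.integral_add_mul v v' hφ.1.continuous hφ.2.1, h φ hφ, h' φ hφ]
  ring

theorem IsWeakDeriv.smul {e : ℝ × ℝ} {u v : L2} (c : ℝ) (h : IsWeakDeriv e u v) :
    IsWeakDeriv e (c • u) (c • v) := by
  intro φ hφ
  rw [L2.integral_smul_mul, L2.integral_smul_mul, h φ hφ]
  ring

/-- The Sobolev space `H¹(Ω)`, as the space of triples `(u, ∂ₓu, ∂ᵧu)` in `L²(Ω)` whose last two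
entries are the weak derivatives of the first one (which determines them). -/
noncomputable def H1 : Submodule ℝ (L2 × L2 × L2) where
  carrier := {w | IsWeakDeriv (1, 0) w.1 w.2.1 ∧ IsWeakDeriv (0, 1) w.1 w.2.2}
  add_mem' ha hb := ⟨ha.1.add hb.1, ha.2.add hb.2⟩
  zero_mem' := by
    have h : ∀ e, IsWeakDeriv e 0 0 := fun e => by
      intro φ _
      have := L2.integral_smul_mul 0 0 (fun z => fderiv ℝ φ z e)
      have h2 := L2.integral_smul_mul 0 0 φ
      rw [zero_smul, zero_mul] at this h2
      rw [this, h2, neg_zero]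
    exact ⟨h _, h _⟩
  smul_mem' c _ h := ⟨h.1.smul c, h.2.smul c⟩

/-- The function underlying an element of `H¹(Ω)`. -/
noncomputable def H1.val (u : H1) : L2 := u.1.1

/-- The weak derivative in `x`. -/
noncomputable def H1.dx (u : H1) : L2 := u.1.2.1

/-- The weak derivative in `y`. -/
noncomputable def H1.dy (u : H1) : L2 := u.1.2.2

/-- `u = g` on `∂Ω` in the sense of traces: some sequence of `C¹` functions on the plane converges
to `u` in `H¹(Ω)`, and its restrictions to the four sides of the square converge to `g` in `L²`. -/
def HasTrace (u : H1) (g : ℝ × ℝ → ℝ) : Prop :=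
  ∃ φ : ℕ → ℝ × ℝ → ℝ, (∀ n, ContDiff ℝ 1 (φ n)) ∧
    Tendsto (fun n => eLpNorm (fun z => φ n z - H1.val u z) 2 muOmega) atTop (𝓝 0) ∧
    Tendsto (fun n => eLpNorm (fun z => fderiv ℝ (φ n) z (1, 0) - H1.dx u z) 2 muOmega)
      atTop (𝓝 0) ∧
    Tendsto (fun n => eLpNorm (fun z => fderiv ℝ (φ n) z (0, 1) - H1.dy u z) 2 muOmega)
      atTop (𝓝 0) ∧
    ∀ s : ℝ, s = 1 ∨ s = -1 →
      Tendsto (fun n => eLpNorm (fun t : ℝ => φ n (s, t) - g (s, t)) 2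
        (volume.restrict (Icc (-1) 1))) atTop (𝓝 0) ∧
      Tendsto (fun n => eLpNorm (fun t : ℝ => φ n (t, s) - g (t, s)) 2
        (volume.restrict (Icc (-1) 1))) atTop (𝓝 0)

/-- The trapezoidal function `T_ε` on `[-1,1]`. -/
noncomputable def trapezoid (ε t : ℝ) : ℝ :=
  if t ≤ -1 + ε then (1 + t) / ε else if t ≤ 1 - ε then 1 else (1 - t) / ε

open Classical in
/-- The tangential boundary datum `P_bc` in rescaled coordinates: the first branch is its value on
the sides `x = ±1`, the second one its value on the sides `y = ±1`. -/
noncomputable def bdryDatum (B C ε : ℝ) (z : ℝ × ℝ) : Matrix (Fin 2) (Fin 2) ℝ :=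
  (B / (2 * C)) •
    if z.1 = 1 ∨ z.1 = -1 then !![-trapezoid ε z.2, 0; 0, trapezoid ε z.2]
    else !![trapezoid ε z.1, 0; 0, -trapezoid ε z.1]

/-- `P ∈ H¹(Ω; S₀)`: a `2 × 2` matrix with entries in `H¹(Ω)`, symmetric and traceless. -/
def IsS0Valued (P : Matrix (Fin 2) (Fin 2) H1) : Prop :=
  P.IsSymm ∧ P.trace = 0

/-- The admissible class `𝒜`. -/
def admissible (B C ε : ℝ) : Set (Matrix (Fin 2) (Fin 2) H1) :=
  {P | IsS0Valued P ∧ ∀ i j, HasTrace (P i j) (fun z => bdryDatum B C ε z i j)}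

/-- `H¹₀(Ω; S₀)`, the space of variations of the affine space `𝒜`. -/
def variations : Set (Matrix (Fin 2) (Fin 2) H1) :=
  {Φ | IsS0Valued Φ ∧ ∀ i j, HasTrace (Φ i j) (fun _ => 0)}

/-- `|M|² = ⟨M, M⟩ = tr (M M)`, for symmetric `M`. -/
def normSq (M : Matrix (Fin 2) (Fin 2) ℝ) : ℝ := (M * M).trace

/-- The rescaled reduced Landau–de Gennes energy. -/
noncomputable def energy (B C b lam : ℝ) (P : Matrix (Fin 2) (Fin 2) H1) : ℝ :=
  ∫ z, (1 / (2 * b ^ 2) * normSq (Matrix.of fun i j => H1.dx (P i j) z)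
    + 1 / 2 * normSq (Matrix.of fun i j => H1.dy (P i j) z)
    + lam ^ 2 / (2 * C) *
      (-(B ^ 2 / (4 * C)) * normSq (Matrix.of fun i j => H1.val (P i j) z)
        + C / 4 * normSq (Matrix.of fun i j => H1.val (P i j) z) ^ 2)) ∂muOmega

/-- Critical points of the energy in `𝒜`: the first variation vanishes in all directions of
`H¹₀(Ω; S₀)`. -/
def IsCriticalPoint (B C ε b lam : ℝ) (P : Matrix (Fin 2) (Fin 2) H1) : Prop :=
  P ∈ admissible B C ε ∧
    ∀ Φ ∈ variations, HasDerivAt (fun t : ℝ => energy B C b lam (P + t • Φ)) 0 0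

end RLdG

namespace RLdG

/-! The energy is strictly convex on `admissible B C ε`. With first row (p, q) the energy is Q(p) +
Q(q) + (λ²/2)∫(p² + q²)², where Q(u) = b⁻²‖u_x‖² + ‖u_y‖² − κ‖u‖² and κ = λ²B²/(4C²). The quartic
part is convex. The quadratic part is convex along differences of admissible fields once κ is small
against the Poincaré constant: functions of zero trace satisfy ‖u‖² ≤ 8‖u_y‖², a bound that does not
involve b. Since S = 4λ²b is fixed, κ = SB²/(16C²b), so the condition on b says exactly κ < 1/16,
and Q is then coercive on functions of zero trace (`quadEnergy_coercive`).

Uniqueness: at a critical point P, convexity gives E(Q) ≥ E(P) plus a coercive term in Q − P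
(`IsCriticalPoint.energy_add_le`); applying this in both directions to two critical points forces
them to agree.

Existence: the same coercivity makes minimizing sequences Cauchy in H¹, so strong limits suffice,
with Fatou's lemma for the quartic term (`exists_pairEnergy_minimizer`). The class is nonempty
because the boundary datum has an explicit Lipschitz extension. A Ladyzhenskaya-type L⁴ bound makes
every integral finite, and the energy is a polynomial on lines, so a minimizer is critical.

Symmetry: the energy and the boundary condition are invariant under q ↦ −q, so uniqueness gives q =
−q, that is q = 0. -/

/-- Lebesgue measure on the interval `[-1,1]`. -/
noncomputable abbrev muI : Measure ℝ := volume.restrict (Icc (-1) 1)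

theorem muOmega_eq_prod : muOmega = muI.prod muI := by
  rw [muOmega, Omega, muI, Measure.prod_restrict, ← Measure.volume_eq_prod]
  refine Measure.restrict_congr_set ?_
  exact Measure.set_prod_ae_eq Ioo_ae_eq_Icc Ioo_ae_eq_Icc

theorem muI_univ : muI univ = 2 := by
  rw [Measure.restrict_apply_univ, Real.volume_Icc]
  norm_num

theorem ennreal_add_sq_le (a b : ENNReal) : (a + b) ^ 2 ≤ 2 * a ^ 2 + 2 * b ^ 2 := by
  have h := ENNReal.rpow_add_le_mul_rpow_add_rpow a b (p := 2) (by norm_num)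
  norm_num at h
  rwa [mul_add] at h

/-! ### L² and L⁴ norms as extended nonnegative integrals. -/

section eLpNormSq

variable {α : Type*} [MeasurableSpace α] {μ : Measure α}

theorem eLpNorm_two_sq (f : α → ℝ) : eLpNorm f 2 μ ^ 2 = ∫⁻ z, ‖f z‖ₑ ^ 2 ∂μ := by
  have h := eLpNorm_nnreal_pow_eq_lintegral (μ := μ) (f := f) (p := 2) (by norm_num)
  simpa using h

theorem eLpNorm_four_pow (f : α → ℝ) : eLpNorm f 4 μ ^ 4 = ∫⁻ z, ‖f z‖ₑ ^ 4 ∂μ := by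
  have h := eLpNorm_nnreal_pow_eq_lintegral (μ := μ) (f := f) (p := 4) (by norm_num)
  simpa using h

/-- Cauchy–Schwarz against the constant 1. -/
theorem lintegral_enorm_sq_le {f : α → ℝ} (hf : AEStronglyMeasurable f μ) :
    (∫⁻ z, ‖f z‖ₑ ∂μ) ^ 2 ≤ μ univ * ∫⁻ z, ‖f z‖ₑ ^ 2 ∂μ := by
  have h := eLpNorm_le_eLpNorm_mul_rpow_measure_univ (p := 1) (q := 2) (by norm_num) hf
  rw [eLpNorm_one_eq_lintegral_enorm] at h
  have h2 := pow_le_pow_left' h 2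
  rw [mul_pow, eLpNorm_two_sq] at h2
  refine h2.trans (le_of_eq ?_)
  rw [mul_comm, ← ENNReal.rpow_natCast (_ ^ _) 2, ← ENNReal.rpow_mul]
  norm_num

theorem tendsto_eLpNorm_of_sub {p : ENNReal} (hp : 1 ≤ p) {f : ℕ → α → ℝ} {g : α → ℝ}
    (hf : ∀ n, AEStronglyMeasurable (f n) μ) (hg : AEStronglyMeasurable g μ)
    (h : Tendsto (fun n => eLpNorm (fun z => f n z - g z) p μ) atTop (𝓝 0)) :
    Tendsto (fun n => eLpNorm (f n) p μ) atTop (𝓝 (eLpNorm g p μ)) := by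
  have h1 : ∀ n, eLpNorm (f n) p μ ≤ eLpNorm g p μ + eLpNorm (fun z => f n z - g z) p μ := by
    intro n
    refine le_trans (le_of_eq ?_) (eLpNorm_add_le hg ((hf n).sub hg) hp)
    congr 1; ext z; simp
  have h2 : ∀ n, eLpNorm g p μ - eLpNorm (fun z => f n z - g z) p μ ≤ eLpNorm (f n) p μ := by
    intro n
    rw [tsub_le_iff_right]
    refine le_trans (le_of_eq ?_) (eLpNorm_sub_le (hf n) ((hf n).sub hg) hp)
    congr 1; ext z; simp
  refine tendsto_of_tendsto_of_tendsto_of_le_of_le ?_ ?_ h2 h1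
  · simpa using ENNReal.Tendsto.sub (tendsto_const_nhds (x := eLpNorm g p μ)) h (by simp)
  · simpa using (tendsto_const_nhds (x := eLpNorm g p μ)).add h

/-- Dominated convergence with a constant majorant; it serves the regularizations of |·| both on the
square and on its sides. -/
theorem tendsto_eLpNorm_of_bounded [IsFiniteMeasure μ] {f : ℕ → α → ℝ} {g : α → ℝ} {M : ℝ}
    (hf : ∀ n, Measurable (f n)) (hg : Measurable g) (hM : ∀ n z, |f n z - g z| ≤ M)
    (h : ∀ z, Tendsto (fun n => f n z) atTop (𝓝 (g z))) :
    Tendsto (fun n => eLpNorm (fun z => f n z - g z) 2 μ) atTop (𝓝 0) := by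
  have h1 : Tendsto (fun n => ∫⁻ z, ‖f n z - g z‖ₑ ^ 2 ∂μ) atTop (𝓝 (∫⁻ _, 0 ∂μ)) := by
    refine tendsto_lintegral_of_dominated_convergence (fun _ => ENNReal.ofReal M ^ 2)
      (fun n => (((hf n).sub hg).enorm).pow_const 2) (fun n => ae_of_all _ fun z => ?_) ?_
      (ae_of_all _ fun z => ?_)
    · dsimp only
      gcongr
      rw [← ofReal_norm]
      exact ENNReal.ofReal_le_ofReal (hM n z)
    · rw [lintegral_const]
      exact ENNReal.mul_ne_top (by simp) (measure_ne_top _ _)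
    · have h2 := (h z).sub_const (g z)
      rw [sub_self] at h2
      simpa [Function.comp_def] using (ENNReal.continuous_pow 2).continuousAt.tendsto.comp h2.enorm
  simp only [lintegral_zero, ← eLpNorm_two_sq] at h1
  have h3 := (ENNReal.continuous_rpow_const (y := 1 / 2)).continuousAt.tendsto.comp h1
  have h4 : ∀ x : ENNReal, (x ^ 2) ^ (2⁻¹ : ℝ) = x := fun x => by
    rw [← ENNReal.rpow_natCast, ← ENNReal.rpow_mul]; norm_num
  simpa [Function.comp_def, h4] using h3

end eLpNormSq

/-! ### Poincaré and Ladyzhenskaya inequalities for C¹ functions. -/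

/-- Fundamental theorem of calculus from the left endpoint, then Cauchy–Schwarz on an interval of
length 2. This length and the 2 of (a + b)² ≤ 2a² + 2b² make the 4. -/
theorem enorm_sq_le_of_contDiff {f f' : ℝ → ℝ} (hf : ∀ t, HasDerivAt f (f' t) t)
    (hf' : Continuous f') {t : ℝ} (ht : t ∈ Icc (-1 : ℝ) 1) :
    ‖f t‖ₑ ^ 2 ≤ 2 * ‖f (-1)‖ₑ ^ 2 + 4 * ∫⁻ s, ‖f' s‖ₑ ^ 2 ∂muI := by
  have h1 : ∫ s in (-1)..t, f' s = f t - f (-1) :=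
    intervalIntegral.integral_eq_sub_of_hasDerivAt (fun x _ => hf x) (hf'.intervalIntegrable _ _)
  have h2 : ‖f t‖ₑ ≤ ‖f (-1)‖ₑ + ∫⁻ s, ‖f' s‖ₑ ∂muI := by
    have : f t = f (-1) + ∫ s in (-1)..t, f' s := by rw [h1]; ring
    rw [this]
    refine (enorm_add_le _ _).trans ?_
    gcongr
    rw [intervalIntegral.integral_of_le ht.1]
    refine (enorm_integral_le_lintegral_enorm _).trans ?_
    exact lintegral_mono_set (fun x hx => ⟨hx.1.le, hx.2.trans ht.2⟩)
  calc ‖f t‖ₑ ^ 2 ≤ (‖f (-1)‖ₑ + ∫⁻ s, ‖f' s‖ₑ ∂muI) ^ 2 := by gcongr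
    _ ≤ 2 * ‖f (-1)‖ₑ ^ 2 + 2 * (∫⁻ s, ‖f' s‖ₑ ∂muI) ^ 2 := ennreal_add_sq_le _ _
    _ ≤ 2 * ‖f (-1)‖ₑ ^ 2 + 2 * (muI univ * ∫⁻ s, ‖f' s‖ₑ ^ 2 ∂muI) := by
        gcongr
        exact lintegral_enorm_sq_le hf'.aestronglyMeasurable
    _ = _ := by rw [muI_univ, ← mul_assoc]; norm_num

section C1

variable {φ : ℝ × ℝ → ℝ}

theorem continuous_fderiv_apply (hφ : ContDiff ℝ 1 φ) (e : ℝ × ℝ) :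
    Continuous fun z => fderiv ℝ φ z e :=
  (hφ.continuous_fderiv (by simp)).clm_apply continuous_const

theorem hasDerivAt_fst (hφ : ContDiff ℝ 1 φ) (x y : ℝ) :
    HasDerivAt (fun s => φ (s, y)) (fderiv ℝ φ (x, y) (1, 0)) x :=
  ((hφ.differentiable (by simp)) (x, y)).hasFDerivAt.comp_hasDerivAt x
    ((hasDerivAt_id x).prodMk (hasDerivAt_const x y))

theorem hasDerivAt_snd (hφ : ContDiff ℝ 1 φ) (x y : ℝ) :
    HasDerivAt (fun s => φ (x, s)) (fderiv ℝ φ (x, y) (0, 1)) y :=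
  ((hφ.differentiable (by simp)) (x, y)).hasFDerivAt.comp_hasDerivAt y
    ((hasDerivAt_const y x).prodMk (hasDerivAt_id y))

/-- The slicewise bound for `φ` along horizontal lines. -/
theorem enorm_sq_le_fst (hφ : ContDiff ℝ 1 φ) {x : ℝ} (hx : x ∈ Icc (-1 : ℝ) 1) (y : ℝ) :
    ‖φ (x, y)‖ₑ ^ 2 ≤ 2 * ‖φ (-1, y)‖ₑ ^ 2 + 4 * ∫⁻ s, ‖fderiv ℝ φ (s, y) (1, 0)‖ₑ ^ 2 ∂muI :=
  enorm_sq_le_of_contDiff (f := fun s => φ (s, y)) (fun s => hasDerivAt_fst hφ s y)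
    ((continuous_fderiv_apply hφ _).comp (by fun_prop)) hx

/-- The slicewise bound for `φ` along vertical lines. -/
theorem enorm_sq_le_snd (hφ : ContDiff ℝ 1 φ) (x : ℝ) {y : ℝ} (hy : y ∈ Icc (-1 : ℝ) 1) :
    ‖φ (x, y)‖ₑ ^ 2 ≤ 2 * ‖φ (x, -1)‖ₑ ^ 2 + 4 * ∫⁻ s, ‖fderiv ℝ φ (x, s) (0, 1)‖ₑ ^ 2 ∂muI :=
  enorm_sq_le_of_contDiff (f := fun s => φ (x, s)) (fun s => hasDerivAt_snd hφ x s)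
    ((continuous_fderiv_apply hφ _).comp (by fun_prop)) hy

theorem measurable_enorm_sq {ψ : ℝ × ℝ → ℝ} (hψ : Continuous ψ) :
    Measurable fun z => ‖ψ z‖ₑ ^ 2 := (hψ.measurable.enorm).pow_const 2

theorem lintegral_snd_bound (hφ : ContDiff ℝ 1 φ) :
    ∫⁻ x, (2 * ‖φ (x, -1)‖ₑ ^ 2 + 4 * ∫⁻ s, ‖fderiv ℝ φ (x, s) (0, 1)‖ₑ ^ 2 ∂muI) ∂muI
      = 2 * eLpNorm (fun x => φ (x, -1)) 2 muI ^ 2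
        + 4 * eLpNorm (fun z => fderiv ℝ φ z (0, 1)) 2 muOmega ^ 2 := by
  have hm := measurable_enorm_sq (continuous_fderiv_apply hφ (0, 1))
  have h0 : Measurable fun x : ℝ => ‖φ (x, -1)‖ₑ ^ 2 :=
    (measurable_enorm_sq hφ.continuous).comp (by fun_prop : Measurable fun x : ℝ => (x, (-1 : ℝ)))
  rw [eLpNorm_two_sq, eLpNorm_two_sq, muOmega_eq_prod, lintegral_prod _ hm.aemeasurable,
    lintegral_add_left (h0.const_mul 2), lintegral_const_mul _ h0,
    lintegral_const_mul _ hm.lintegral_prod_right']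

theorem lintegral_fst_bound (hφ : ContDiff ℝ 1 φ) :
    ∫⁻ y, (2 * ‖φ (-1, y)‖ₑ ^ 2 + 4 * ∫⁻ s, ‖fderiv ℝ φ (s, y) (1, 0)‖ₑ ^ 2 ∂muI) ∂muI
      = 2 * eLpNorm (fun y => φ (-1, y)) 2 muI ^ 2
        + 4 * eLpNorm (fun z => fderiv ℝ φ z (1, 0)) 2 muOmega ^ 2 := by
  have hm := measurable_enorm_sq (continuous_fderiv_apply hφ (1, 0))
  have h0 : Measurable fun y : ℝ => ‖φ (-1, y)‖ₑ ^ 2 :=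
    (measurable_enorm_sq hφ.continuous).comp (by fun_prop : Measurable fun y : ℝ => ((-1 : ℝ), y))
  rw [eLpNorm_two_sq, eLpNorm_two_sq, muOmega_eq_prod, lintegral_prod_symm _ hm.aemeasurable,
    lintegral_add_left (h0.const_mul 2), lintegral_const_mul _ h0,
    lintegral_const_mul _ hm.lintegral_prod_left']

/-- The vertical slice bound does not depend on y, so integrating it over y only doubles it. Only
the y-derivative enters, which keeps the final constant free of b. -/
theorem poincare_C1 (hφ : ContDiff ℝ 1 φ) :
    eLpNorm φ 2 muOmega ^ 2 ≤ 4 * eLpNorm (fun x => φ (x, -1)) 2 muI ^ 2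
        + 8 * eLpNorm (fun z => fderiv ℝ φ z (0, 1)) 2 muOmega ^ 2 := by
  have h : eLpNorm φ 2 muOmega ^ 2 ≤ 2 * ∫⁻ x, (2 * ‖φ (x, -1)‖ₑ ^ 2
      + 4 * ∫⁻ s, ‖fderiv ℝ φ (x, s) (0, 1)‖ₑ ^ 2 ∂muI) ∂muI := by
    rw [eLpNorm_two_sq, muOmega_eq_prod,
      lintegral_prod _ (measurable_enorm_sq hφ.continuous).aemeasurable,
      ← lintegral_const_mul' _ _ (by norm_num)]
    refine lintegral_mono fun x => ?_
    rw [mul_comm (2 : ENNReal) (_ + _), ← muI_univ, ← lintegral_const, muI_univ]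
    refine setLIntegral_mono' measurableSet_Icc fun y hy => ?_
    exact enorm_sq_le_snd hφ x hy
  rw [lintegral_snd_bound hφ] at h
  refine h.trans (le_of_eq ?_)
  rw [mul_add, ← mul_assoc, ← mul_assoc]
  norm_num

/-- Split |φ|⁴ = |φ|²·|φ|² and bound one factor by a function of x alone (vertical slices), the
other by a function of y alone (horizontal slices); the double integral of the product then
factorizes. -/
theorem ladyzhenskaya_C1 (hφ : ContDiff ℝ 1 φ) :
    eLpNorm φ 4 muOmega ^ 4 ≤
      (2 * eLpNorm (fun x => φ (x, -1)) 2 muI ^ 2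
        + 4 * eLpNorm (fun z => fderiv ℝ φ z (0, 1)) 2 muOmega ^ 2) *
      (2 * eLpNorm (fun y => φ (-1, y)) 2 muI ^ 2
        + 4 * eLpNorm (fun z => fderiv ℝ φ z (1, 0)) 2 muOmega ^ 2) := by
  have hy := measurable_enorm_sq (continuous_fderiv_apply hφ (0, 1))
  have hx := measurable_enorm_sq (continuous_fderiv_apply hφ (1, 0))
  have h0 := measurable_enorm_sq hφ.continuous
  rw [← lintegral_snd_bound hφ, ← lintegral_fst_bound hφ, ← lintegral_prod_mul,
    eLpNorm_four_pow, muOmega_eq_prod, Measure.prod_restrict]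
  · refine setLIntegral_mono' (measurableSet_Icc.prod measurableSet_Icc) fun z hz => ?_
    have e : ‖φ z‖ₑ ^ 4 = ‖φ (z.1, z.2)‖ₑ ^ 2 * ‖φ (z.1, z.2)‖ₑ ^ 2 := by rw [← pow_add]
    rw [e]
    exact mul_le_mul' (enorm_sq_le_snd hφ z.1 hz.2) (enorm_sq_le_fst hφ hz.1 z.2)
  · refine (Measurable.add ?_ (hy.lintegral_prod_right'.const_mul 4)).aemeasurable
    exact (h0.comp (by fun_prop : Measurable fun x : ℝ => (x, (-1 : ℝ)))).const_mul 2
  · refine (Measurable.add ?_ (hx.lintegral_prod_left'.const_mul 4)).aemeasurable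
    exact (h0.comp (by fun_prop : Measurable fun y : ℝ => ((-1 : ℝ), y))).const_mul 2

end C1

/-! ### Passage of the inequalities from C¹ functions to H¹ functions with traces. -/

theorem L2.aesm (u : L2) : AEStronglyMeasurable (u : ℝ × ℝ → ℝ) muOmega :=
  (Lp.memLp u).1

theorem L2.norm_sq (u : L2) : ‖u‖ ^ 2 = (eLpNorm u 2 muOmega ^ 2).toReal := by
  rw [Lp.norm_def, ENNReal.toReal_pow]

/-- Poincaré's inequality for functions in `H¹` with zero trace. -/
theorem HasTrace.poincare {u : H1} (h : HasTrace u fun _ => 0) :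
    ‖H1.val u‖ ^ 2 ≤ 8 * ‖H1.dy u‖ ^ 2 := by
  obtain ⟨φ, hφ, h0, -, hy, hb⟩ := h
  have t0 := tendsto_eLpNorm_of_sub (by norm_num)
    (fun n => (hφ n).continuous.aestronglyMeasurable) (L2.aesm _) h0
  have ty := tendsto_eLpNorm_of_sub (by norm_num)
    (fun n => (continuous_fderiv_apply (hφ n) _).aestronglyMeasurable) (L2.aesm _) hy
  have tb := (hb (-1) (Or.inr rfl)).2
  simp only [sub_zero] at tb
  -- The term from the bottom side tends to 0 because the trace vanishes.
  have key := le_of_tendsto_of_tendsto' (t0.ennrpow_const 2)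
    (((ENNReal.Tendsto.const_mul (tb.ennrpow_const 2) (Or.inr (by norm_num : (4 : ENNReal) ≠ ⊤))).add
    (ENNReal.Tendsto.const_mul (ty.ennrpow_const 2) (Or.inr (by norm_num : (8 : ENNReal) ≠ ⊤)))))
    (fun n => by simpa using poincare_C1 (hφ n))
  simp only [ENNReal.rpow_ofNat] at key
  rw [L2.norm_sq, L2.norm_sq]
  have h8 : (8 : ℝ) = (8 : ENNReal).toReal := by simp
  rw [h8, ← ENNReal.toReal_mul]
  refine ENNReal.toReal_mono ?_ (by simpa using key)
  exact ENNReal.mul_ne_top (by norm_num) (ENNReal.pow_ne_top (Lp.memLp (H1.dy u)).2.ne)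

/-- Functions in `H¹` with square-integrable trace lie in `L⁴`. -/
theorem HasTrace.memLp_four {u : H1} {g : ℝ × ℝ → ℝ} (h : HasTrace u g)
    (hg1 : MemLp (fun t => g (-1, t)) 2 muI) (hg2 : MemLp (fun t => g (t, -1)) 2 muI) :
    MemLp (H1.val u) 4 muOmega := by
  obtain ⟨φ, hφ, h0, hx, hy, hb⟩ := h
  have tx := tendsto_eLpNorm_of_sub (by norm_num)
    (fun n => (continuous_fderiv_apply (hφ n) _).aestronglyMeasurable) (L2.aesm _) hx
  have ty := tendsto_eLpNorm_of_sub (by norm_num)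
    (fun n => (continuous_fderiv_apply (hφ n) _).aestronglyMeasurable) (L2.aesm _) hy
  have c1 : ∀ n, Continuous fun t : ℝ => φ n (-1, t) := fun n => (hφ n).continuous.comp (by fun_prop)
  have c2 : ∀ n, Continuous fun t : ℝ => φ n (t, -1) := fun n => (hφ n).continuous.comp (by fun_prop)
  have tb1 := tendsto_eLpNorm_of_sub (by norm_num)
    (fun n => (c1 n).aestronglyMeasurable) hg1.1 (hb (-1) (Or.inr rfl)).1
  have tb2 := tendsto_eLpNorm_of_sub (by norm_num)
    (fun n => (c2 n).aestronglyMeasurable) hg2.1 (hb (-1) (Or.inr rfl)).2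
  obtain ⟨ns, hns, hae⟩ := (tendstoInMeasure_of_tendsto_eLpNorm (by norm_num)
    (fun n => (hφ n).continuous.aestronglyMeasurable) (L2.aesm (H1.val u)) h0).exists_seq_tendsto_ae
  have b2 : (2 : ENNReal) ≠ ⊤ := by norm_num
  have b4 : (4 : ENNReal) ≠ ⊤ := by norm_num
  have n2 : ∀ {α : Type} [MeasurableSpace α] {μ : Measure α} {f : α → ℝ}, MemLp f 2 μ →
    eLpNorm f 2 μ ^ (2 : ℝ) ≠ ⊤ := fun hf => by simpa using hf.2.ne
  -- Both limiting factors must be finite, since multiplication of extended reals is not continuous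
  -- at (0, ∞).
  have f1 : 2 * eLpNorm (fun t => g (t, -1)) 2 muI ^ (2 : ℝ)
      + 4 * eLpNorm (H1.dy u) 2 muOmega ^ (2 : ℝ) ≠ ⊤ :=
    ENNReal.add_ne_top.2 ⟨ENNReal.mul_ne_top b2 (n2 hg2), ENNReal.mul_ne_top b4 (n2 (Lp.memLp _))⟩
  have f2 : 2 * eLpNorm (fun t => g (-1, t)) 2 muI ^ (2 : ℝ)
      + 4 * eLpNorm (H1.dx u) 2 muOmega ^ (2 : ℝ) ≠ ⊤ :=
    ENNReal.add_ne_top.2 ⟨ENNReal.mul_ne_top b2 (n2 hg1), ENNReal.mul_ne_top b4 (n2 (Lp.memLp _))⟩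
  have lim := ENNReal.Tendsto.mul
    ((ENNReal.Tendsto.const_mul (tb2.ennrpow_const 2) (Or.inr b2)).add
      (ENNReal.Tendsto.const_mul (ty.ennrpow_const 2) (Or.inr b4))) (Or.inr f2)
    ((ENNReal.Tendsto.const_mul (tb1.ennrpow_const 2) (Or.inr b2)).add
      (ENNReal.Tendsto.const_mul (tx.ennrpow_const 2) (Or.inr b4))) (Or.inr f1)
  obtain ⟨K, hK⟩ := ENNReal.lt_iff_exists_nnreal_btwn.1 (ENNReal.mul_ne_top f1 f2).lt_top
  have ev := lim.eventually_lt_const hK.1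
  refine ⟨L2.aesm _, ?_⟩
  -- Lower semicontinuity of the L⁴ norm along an a.e. convergent subsequence, whose L⁴ norms are
  -- eventually at most `K ^ (1 / 4)`.
  refine (Lp.eLpNorm_lim_le_liminf_eLpNorm
    (fun n => (hφ (ns n)).continuous.aestronglyMeasurable) _ hae).trans_lt ?_
  refine lt_of_le_of_lt (b := (K : ENNReal) ^ (1 / 4 : ℝ)) ?_
    (ENNReal.rpow_lt_top_of_nonneg (by norm_num) (by simp))
  refine liminf_le_of_frequently_le' (Eventually.frequently ?_)
  filter_upwards [hns.tendsto_atTop.eventually ev] with n hn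
  have h4 := ladyzhenskaya_C1 (hφ (ns n))
  simp only [ENNReal.rpow_ofNat] at hn
  have h5 := ENNReal.rpow_le_rpow (h4.trans hn.le) (z := 1 / 4) (by norm_num)
  rwa [← ENNReal.rpow_natCast, ← ENNReal.rpow_mul, Nat.cast_ofNat, mul_one_div_cancel (by norm_num),
    ENNReal.rpow_one] at h5

theorem memLp_two_muI {f : ℝ → ℝ} (hf : Continuous f) : MemLp f 2 muI := by
  obtain ⟨K, hK⟩ := (isCompact_Icc (a := (-1 : ℝ)) (b := 1)).exists_bound_of_continuousOn
    hf.continuousOn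
  exact MemLp.of_bound hf.aestronglyMeasurable K
    ((ae_restrict_iff' measurableSet_Icc).2 (ae_of_all _ hK))

theorem memLp_two_muOmega {f : ℝ × ℝ → ℝ} (hf : Continuous f) : MemLp f 2 muOmega := by
  obtain ⟨K, hK⟩ := ((isCompact_Icc (a := (-1 : ℝ)) (b := 1)).prod
    (isCompact_Icc (a := (-1 : ℝ)) (b := 1))).exists_bound_of_continuousOn hf.continuousOn
  refine MemLp.of_bound hf.aestronglyMeasurable K ?_
  rw [muOmega_eq_prod, Measure.prod_restrict]
  exact (ae_restrict_iff' (measurableSet_Icc.prod measurableSet_Icc)).2 (ae_of_all _ hK)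

/-- Some φₙ lies at finite L² distance from g on the side and is itself square integrable there. -/
theorem HasTrace.memLp_left {u : H1} {g : ℝ × ℝ → ℝ} (h : HasTrace u g) (hg : Measurable g) :
    MemLp (fun t => g (-1, t)) 2 muI := by
  obtain ⟨φ, hφ, -, -, -, hb⟩ := h
  obtain ⟨n, hn⟩ := ((hb (-1) (Or.inr rfl)).1.eventually_lt_const one_pos).exists
  have c : Continuous fun t : ℝ => φ n (-1, t) := (hφ n).continuous.comp (by fun_prop)
  have m : Measurable fun t : ℝ => g (-1, t) := hg.comp (by fun_prop)
  have hd : MemLp (fun t => φ n (-1, t) - g (-1, t)) 2 muI :=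
    ⟨(c.measurable.sub m).aestronglyMeasurable, hn.trans ENNReal.one_lt_top⟩
  refine ((memLp_two_muI c).sub hd).congr_norm m.aestronglyMeasurable (ae_of_all _ fun t => ?_)
  simp

theorem HasTrace.memLp_bottom {u : H1} {g : ℝ × ℝ → ℝ} (h : HasTrace u g) (hg : Measurable g) :
    MemLp (fun t => g (t, -1)) 2 muI := by
  obtain ⟨φ, hφ, -, -, -, hb⟩ := h
  obtain ⟨n, hn⟩ := ((hb (-1) (Or.inr rfl)).2.eventually_lt_const one_pos).exists
  have c : Continuous fun t : ℝ => φ n (t, -1) := (hφ n).continuous.comp (by fun_prop)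
  have m : Measurable fun t : ℝ => g (t, -1) := hg.comp (by fun_prop)
  have hd : MemLp (fun t => φ n (t, -1) - g (t, -1)) 2 muI :=
    ⟨(c.measurable.sub m).aestronglyMeasurable, hn.trans ENNReal.one_lt_top⟩
  refine ((memLp_two_muI c).sub hd).congr_norm m.aestronglyMeasurable (ae_of_all _ fun t => ?_)
  simp

/-! ### Completeness of H¹ and stability of the trace condition. -/

/-- The functional is an inner product with a fixed element of L². Hence each weak-derivative
identity is a closed condition, and H¹ is closed in L² × L² × L². -/
theorem L2.continuous_integral_mul {ψ : ℝ × ℝ → ℝ} (hc : Continuous ψ) :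
    Continuous fun u : L2 => ∫ z, u z * ψ z ∂muOmega := by
  have h : ∀ u : L2, ∫ z, u z * ψ z ∂muOmega = inner ℝ ((memLp_two_muOmega hc).toLp ψ) u := by
    intro u
    rw [MeasureTheory.L2.inner_def]
    refine integral_congr_ae ?_
    filter_upwards [(memLp_two_muOmega hc).coeFn_toLp] with z hz
    simp [hz]
  simp only [h]
  fun_prop

theorem isClosed_isWeakDeriv (e : ℝ × ℝ) : IsClosed {w : L2 × L2 | IsWeakDeriv e w.1 w.2} := by
  simp only [IsWeakDeriv, ofPred_forall]
  refine isClosed_iInter fun φ => isClosed_iInter fun hφ => ?_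
  exact isClosed_eq ((L2.continuous_integral_mul (hφ.continuous_deriv e)).comp continuous_fst)
    ((L2.continuous_integral_mul hφ.1.continuous).comp continuous_snd).neg

theorem isClosed_H1 : IsClosed (H1 : Set (L2 × L2 × L2)) := by
  have h : (H1 : Set (L2 × L2 × L2)) =
      (fun w => (w.1, w.2.1)) ⁻¹' {w : L2 × L2 | IsWeakDeriv (1, 0) w.1 w.2} ∩
      (fun w => (w.1, w.2.2)) ⁻¹' {w : L2 × L2 | IsWeakDeriv (0, 1) w.1 w.2} := rfl
  rw [h]
  exact ((isClosed_isWeakDeriv _).preimage (by fun_prop)).inter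
    ((isClosed_isWeakDeriv _).preimage (by fun_prop))

instance : CompleteSpace H1 := isClosed_H1.completeSpace_coe

theorem integral_muOmega_eq {f g : ℝ × ℝ → ℝ} (h : f =ᵐ[muOmega] g) (h0 : ∀ z, z ∉ Omega → g z = 0) :
    ∫ z, f z ∂muOmega = ∫ z, g z :=
  (integral_congr_ae h).trans (setIntegral_eq_integral_of_forall_compl_eq_zero h0)

/-- Integration by parts on the whole plane: the test function is supported inside the square, so
both integrals extend by zero and no boundary term appears. -/
theorem isWeakDeriv_of_C1 {φ : ℝ × ℝ → ℝ} (hφ : ContDiff ℝ 1 φ) (e : ℝ × ℝ) :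
    IsWeakDeriv e ((memLp_two_muOmega hφ.continuous).toLp φ)
      ((memLp_two_muOmega (continuous_fderiv_apply hφ e)).toLp fun z => fderiv ℝ φ z e) := by
  intro ψ hψ
  have e1 : ∫ z, (memLp_two_muOmega hφ.continuous).toLp φ z * fderiv ℝ ψ z e ∂muOmega
      = ∫ z, φ z * fderiv ℝ ψ z e := by
    refine integral_muOmega_eq ?_ fun z hz => ?_
    · filter_upwards [(memLp_two_muOmega hφ.continuous).coeFn_toLp] with z hz
      rw [hz]
    · have : fderiv ℝ ψ z = 0 := by
        by_contra h
        exact hz (hψ.2.2 (support_fderiv_subset ℝ h))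
      simp [this]
  have e2 : ∫ z, (memLp_two_muOmega (continuous_fderiv_apply hφ e)).toLp
      (fun z => fderiv ℝ φ z e) z * ψ z ∂muOmega = ∫ z, fderiv ℝ φ z e * ψ z := by
    refine integral_muOmega_eq ?_ fun z hz => ?_
    · filter_upwards [(memLp_two_muOmega (continuous_fderiv_apply hφ e)).coeFn_toLp] with z hz
      rw [hz]
    · have : ψ z = 0 := by
        by_contra h
        exact hz (hψ.2.2 (subset_tsupport _ h))
      simp [this]
  rw [e1, e2]
  refine integral_mul_fderiv_eq_neg_fderiv_mul_of_integrable ?_ ?_ ?_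
    (fun z _ => hφ.differentiable (by simp) z) (fun z _ => hψ.1.differentiable (by simp) z)
  · exact ((continuous_fderiv_apply hφ e).mul hψ.1.continuous).integrable_of_hasCompactSupport
      (hψ.2.1.mul_left)
  · exact (hφ.continuous.mul (hψ.continuous_deriv e)).integrable_of_hasCompactSupport
      ((hψ.compact_deriv e).mul_left)
  · exact (hφ.continuous.mul hψ.1.continuous).integrable_of_hasCompactSupport (hψ.2.1.mul_left)

/-- A limit of `C¹` functions whose gradients converge in `L²` is an element of `H¹`. -/
theorem mem_H1_of_tendsto {φ : ℕ → ℝ × ℝ → ℝ} (hφ : ∀ n, ContDiff ℝ 1 (φ n)) {u v w : ℝ × ℝ → ℝ}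
    (hu : MemLp u 2 muOmega) (hv : MemLp v 2 muOmega) (hw : MemLp w 2 muOmega)
    (h0 : Tendsto (fun n => eLpNorm (fun z => φ n z - u z) 2 muOmega) atTop (𝓝 0))
    (hx : Tendsto (fun n => eLpNorm (fun z => fderiv ℝ (φ n) z (1, 0) - v z) 2 muOmega)
      atTop (𝓝 0))
    (hy : Tendsto (fun n => eLpNorm (fun z => fderiv ℝ (φ n) z (0, 1) - w z) 2 muOmega)
      atTop (𝓝 0)) :
    (hu.toLp u, hv.toLp v, hw.toLp w) ∈ H1 := by
  have t0 := (Lp.tendsto_Lp_iff_tendsto_eLpNorm'' _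
    (fun n => memLp_two_muOmega (hφ n).continuous) u hu).2 h0
  have tx := (Lp.tendsto_Lp_iff_tendsto_eLpNorm'' _
    (fun n => memLp_two_muOmega (continuous_fderiv_apply (hφ n) (1, 0))) v hv).2 hx
  have ty := (Lp.tendsto_Lp_iff_tendsto_eLpNorm'' _
    (fun n => memLp_two_muOmega (continuous_fderiv_apply (hφ n) (0, 1))) w hw).2 hy
  exact isClosed_H1.mem_of_tendsto (t0.prodMk_nhds (tx.prodMk_nhds ty))
    (Eventually.of_forall fun n => ⟨isWeakDeriv_of_C1 (hφ n) _, isWeakDeriv_of_C1 (hφ n) _⟩)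

theorem tendsto_eLpNorm_linComb {α : Type*} [MeasurableSpace α] {μ : Measure α}
    {f g : ℕ → α → ℝ} {F G H : α → ℝ} (a c : ℝ)
    (hf : ∀ n, AEStronglyMeasurable (f n) μ) (hg : ∀ n, AEStronglyMeasurable (g n) μ)
    (hF : AEStronglyMeasurable F μ) (hG : AEStronglyMeasurable G μ)
    (hH : H =ᵐ[μ] fun z => a * F z + c * G z)
    (h1 : Tendsto (fun n => eLpNorm (fun z => f n z - F z) 2 μ) atTop (𝓝 0))
    (h2 : Tendsto (fun n => eLpNorm (fun z => g n z - G z) 2 μ) atTop (𝓝 0)) :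
    Tendsto (fun n => eLpNorm (fun z => (a * f n z + c * g n z) - H z) 2 μ) atTop (𝓝 0) := by
  have h3 := (ENNReal.Tendsto.const_mul h1 (Or.inr (enorm_ne_top (x := a)))).add
    (ENNReal.Tendsto.const_mul h2 (Or.inr (enorm_ne_top (x := c))))
  simp only [mul_zero, add_zero] at h3
  refine tendsto_of_tendsto_of_tendsto_of_le_of_le tendsto_const_nhds h3 (fun _ => zero_le)
    fun n => ?_
  dsimp only
  have e : (fun z => (a * f n z + c * g n z) - H z) =ᵐ[μ]
      a • (fun z => f n z - F z) + c • (fun z => g n z - G z) := by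
    filter_upwards [hH] with z hz
    simp only [hz, Pi.add_apply, Pi.smul_apply, smul_eq_mul]
    ring
  rw [eLpNorm_congr_ae e, ← eLpNorm_const_smul, ← eLpNorm_const_smul]
  exact eLpNorm_add_le (((hf n).sub hF).const_smul a) (((hg n).sub hG).const_smul c) (by norm_num)

theorem L2.coeFn_linComb (a c : ℝ) (u v : L2) :
    (a • u + c • v : L2) =ᵐ[muOmega] fun z => a * u z + c * v z := by
  filter_upwards [Lp.coeFn_add (a • u) (c • v), Lp.coeFn_smul a u, Lp.coeFn_smul c v]
    with z h1 h2 h3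
  rw [h1, Pi.add_apply, h2, h3]
  rfl

theorem HasTrace.linComb {u v : H1} {g h : ℝ × ℝ → ℝ} (hu : HasTrace u g) (hv : HasTrace v h)
    (hg : Measurable g) (hh : Measurable h) (a c : ℝ) :
    HasTrace (a • u + c • v) fun z => a * g z + c * h z := by
  obtain ⟨φ, hφ, h0, hx, hy, hb⟩ := hu
  obtain ⟨ψ, hψ, k0, kx, ky, kb⟩ := hv
  have hd : ∀ n z e, fderiv ℝ (fun z => a * φ n z + c * ψ n z) z e
      = a * fderiv ℝ (φ n) z e + c * fderiv ℝ (ψ n) z e := by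
    intro n z e
    have h1 := ((hφ n).differentiable (by simp) z).hasFDerivAt.const_mul a
    have h2 := ((hψ n).differentiable (by simp) z).hasFDerivAt.const_mul c
    have h3 := (h1.add h2).fderiv
    refine (congrArg (fun L : ℝ × ℝ →L[ℝ] ℝ => L e) h3).trans ?_
    simp
  refine ⟨fun n z => a * φ n z + c * ψ n z,
    fun n => (contDiff_const.mul (hφ n)).add (contDiff_const.mul (hψ n)), ?_, ?_, ?_, ?_⟩
  · exact tendsto_eLpNorm_linComb a c (fun n => (hφ n).continuous.aestronglyMeasurable)
      (fun n => (hψ n).continuous.aestronglyMeasurable) (L2.aesm _) (L2.aesm _)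
      (L2.coeFn_linComb a c _ _) h0 k0
  · simp only [hd]
    exact tendsto_eLpNorm_linComb a c
      (fun n => (continuous_fderiv_apply (hφ n) _).aestronglyMeasurable)
      (fun n => (continuous_fderiv_apply (hψ n) _).aestronglyMeasurable) (L2.aesm _) (L2.aesm _)
      (L2.coeFn_linComb a c _ _) hx kx
  · simp only [hd]
    exact tendsto_eLpNorm_linComb a c
      (fun n => (continuous_fderiv_apply (hφ n) _).aestronglyMeasurable)
      (fun n => (continuous_fderiv_apply (hψ n) _).aestronglyMeasurable) (L2.aesm _) (L2.aesm _)
      (L2.coeFn_linComb a c _ _) hy ky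
  · intro s hs
    have c1 : Continuous fun t : ℝ => (s, t) := by fun_prop
    have c2 : Continuous fun t : ℝ => (t, s) := by fun_prop
    exact ⟨tendsto_eLpNorm_linComb a c
        (fun n => ((hφ n).continuous.comp c1).aestronglyMeasurable)
        (fun n => ((hψ n).continuous.comp c1).aestronglyMeasurable)
        (hg.comp c1.measurable).aestronglyMeasurable (hh.comp c1.measurable).aestronglyMeasurable
        (ae_eq_refl _) (hb s hs).1 (kb s hs).1,
      tendsto_eLpNorm_linComb a c
        (fun n => ((hφ n).continuous.comp c2).aestronglyMeasurable)
        (fun n => ((hψ n).continuous.comp c2).aestronglyMeasurable)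
        (hg.comp c2.measurable).aestronglyMeasurable (hh.comp c2.measurable).aestronglyMeasurable
        (ae_eq_refl _) (hb s hs).2 (kb s hs).2⟩

theorem HasTrace.congr {u : H1} {g h : ℝ × ℝ → ℝ} (hu : HasTrace u g)
    (hgh : ∀ s : ℝ, s = 1 ∨ s = -1 → ∀ t ∈ Icc (-1 : ℝ) 1, g (s, t) = h (s, t) ∧ g (t, s) = h (t, s)) :
    HasTrace u h := by
  obtain ⟨φ, hφ, h0, hx, hy, hb⟩ := hu
  refine ⟨φ, hφ, h0, hx, hy, fun s hs => ⟨?_, ?_⟩⟩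
  · refine (hb s hs).1.congr fun n => eLpNorm_congr_ae ?_
    refine (ae_restrict_iff' measurableSet_Icc).2 (ae_of_all _ fun t ht => ?_)
    simp only [(hgh s hs t ht).1]
  · refine (hb s hs).2.congr fun n => eLpNorm_congr_ae ?_
    refine (ae_restrict_iff' measurableSet_Icc).2 (ae_of_all _ fun t ht => ?_)
    simp only [(hgh s hs t ht).2]

theorem hasTrace_zero : HasTrace 0 fun _ => 0 := by
  have h : ((0 : L2) : ℝ × ℝ → ℝ) =ᵐ[muOmega] 0 := Lp.coeFn_zero _ _ _
  have h' : eLpNorm ((0 : L2) : ℝ × ℝ → ℝ) 2 muOmega = 0 := by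
    rw [eLpNorm_congr_ae h, eLpNorm_zero]
  have h2 : ∀ w : L2, w = 0 → eLpNorm (fun z => (0 : ℝ) - w z) 2 muOmega = 0 := by
    rintro w rfl
    have : (fun z => (0 : ℝ) - (0 : L2) z) = -((0 : L2) : ℝ × ℝ → ℝ) := by ext; simp
    rw [this, eLpNorm_neg, h']
  refine ⟨fun _ _ => 0, fun _ => contDiff_const, ?_, ?_, ?_, fun s _ => ⟨?_, ?_⟩⟩
  · simp only [h2 _ (rfl : H1.val 0 = 0), tendsto_const_nhds]
  · simp only [fderiv_fun_const, Pi.zero_apply, zero_apply,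
      h2 _ (rfl : H1.dx 0 = 0), tendsto_const_nhds]
  · simp only [fderiv_fun_const, Pi.zero_apply, zero_apply,
      h2 _ (rfl : H1.dy 0 = 0), tendsto_const_nhds]
  · simp
  · simp

/-- The trace condition is closed under convergence in `H¹`. -/
theorem HasTrace.of_tendsto {u : ℕ → H1} {v : H1} {g : ℝ × ℝ → ℝ} (hu : ∀ k, HasTrace (u k) g)
    (h : Tendsto u atTop (𝓝 v)) : HasTrace v g := by
  have hδ : Tendsto (fun k : ℕ => ((k : ENNReal) + 1)⁻¹) atTop (𝓝 0) := by
    have := ENNReal.tendsto_inv_nat_nhds_zero.comp (tendsto_add_atTop_nat 1)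
    simpa [Function.comp_def] using this
  have hpos : ∀ k : ℕ, 0 < ((k : ENNReal) + 1)⁻¹ := fun k => by simp
  -- Diagonal argument: for each k, one C¹ function is within 1/(k + 1) of `u k` and of the boundary
  -- values in all the required norms.
  have key : ∀ k, ∃ φ : ℝ × ℝ → ℝ, ContDiff ℝ 1 φ ∧
      eLpNorm (fun z => φ z - H1.val (u k) z) 2 muOmega < ((k : ENNReal) + 1)⁻¹ ∧
      eLpNorm (fun z => fderiv ℝ φ z (1, 0) - H1.dx (u k) z) 2 muOmega < ((k : ENNReal) + 1)⁻¹ ∧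
      eLpNorm (fun z => fderiv ℝ φ z (0, 1) - H1.dy (u k) z) 2 muOmega < ((k : ENNReal) + 1)⁻¹ ∧
      ∀ s : ℝ, s = 1 ∨ s = -1 →
        eLpNorm (fun t : ℝ => φ (s, t) - g (s, t)) 2 muI < ((k : ENNReal) + 1)⁻¹ ∧
        eLpNorm (fun t : ℝ => φ (t, s) - g (t, s)) 2 muI < ((k : ENNReal) + 1)⁻¹ := by
    intro k
    obtain ⟨φ, hφ, h0, hx, hy, hb⟩ := hu k
    have hb1 := hb 1 (Or.inl rfl)
    have hb2 := hb (-1) (Or.inr rfl)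
    obtain ⟨n, h⟩ := ((h0.eventually_lt_const (hpos k)).and
      ((hx.eventually_lt_const (hpos k)).and ((hy.eventually_lt_const (hpos k)).and
      (((hb1.1.eventually_lt_const (hpos k)).and (hb1.2.eventually_lt_const (hpos k))).and
      ((hb2.1.eventually_lt_const (hpos k)).and
        (hb2.2.eventually_lt_const (hpos k))))))).exists
    refine ⟨φ n, hφ n, h.1, h.2.1, h.2.2.1, ?_⟩
    rintro s (rfl | rfl)
    exacts [h.2.2.2.1, h.2.2.2.2]
  choose φ hφ h0 hx hy hb using key
  have step : ∀ (f : ℕ → ℝ × ℝ → ℝ) (w : ℕ → L2) (w' : L2), (∀ k, Continuous (f k)) →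
      (∀ k : ℕ, eLpNorm (fun z => f k z - w k z) 2 muOmega < ((k : ENNReal) + 1)⁻¹) →
      Tendsto w atTop (𝓝 w') →
      Tendsto (fun k => eLpNorm (fun z => f k z - w' z) 2 muOmega) atTop (𝓝 0) := by
    intro f w w' hf hfw hw
    have h1 := (Lp.tendsto_Lp_iff_tendsto_eLpNorm' _ _).1 hw
    have h2 := hδ.add h1
    rw [add_zero] at h2
    refine tendsto_of_tendsto_of_tendsto_of_le_of_le tendsto_const_nhds h2 (fun _ => zero_le)
      fun k => ?_
    dsimp only
    refine le_trans ?_ (add_le_add_left (hfw k).le _)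
    refine le_trans (le_of_eq ?_) (eLpNorm_add_le ((hf k).aestronglyMeasurable.sub (L2.aesm (w k)))
      ((L2.aesm (w k)).sub (L2.aesm w')) (by norm_num))
    congr 1; ext z; simp
  have hval : Continuous H1.val := continuous_fst.comp continuous_subtype_val
  have hdx : Continuous H1.dx := (continuous_fst.comp continuous_snd).comp continuous_subtype_val
  have hdy : Continuous H1.dy := (continuous_snd.comp continuous_snd).comp continuous_subtype_val
  refine ⟨φ, hφ, ?_, ?_, ?_, fun s hs => ⟨?_, ?_⟩⟩
  · exact step _ _ _ (fun k => (hφ k).continuous) h0 ((hval.tendsto v).comp h)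
  · exact step _ _ _ (fun k => continuous_fderiv_apply (hφ k) _) hx ((hdx.tendsto v).comp h)
  · exact step _ _ _ (fun k => continuous_fderiv_apply (hφ k) _) hy ((hdy.tendsto v).comp h)
  · exact tendsto_of_tendsto_of_tendsto_of_le_of_le tendsto_const_nhds hδ (fun _ => zero_le)
      fun k => (hb k s hs).1.le
  · exact tendsto_of_tendsto_of_tendsto_of_le_of_le tendsto_const_nhds hδ (fun _ => zero_le)
      fun k => (hb k s hs).2.le

/-! ### An H¹ extension of the boundary datum. -/

/-- A smooth approximation of the absolute value. -/
noncomputable def smoothAbs (n : ℕ) (s : ℝ) : ℝ := √(s ^ 2 + 1 / ((n : ℝ) + 1))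

theorem smoothAbs_arg_pos (n : ℕ) (s : ℝ) : 0 < s ^ 2 + 1 / ((n : ℝ) + 1) := by positivity

theorem abs_le_smoothAbs (n : ℕ) (s : ℝ) : |s| ≤ smoothAbs n s :=
  Real.abs_le_sqrt (le_add_of_nonneg_right (by positivity))

theorem smoothAbs_pos (n : ℕ) (s : ℝ) : 0 < smoothAbs n s :=
  Real.sqrt_pos.2 (smoothAbs_arg_pos n s)

theorem smoothAbs_le (n : ℕ) (s : ℝ) : smoothAbs n s ≤ |s| + 1 := by
  refine Real.sqrt_le_iff.2 ⟨by positivity, ?_⟩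
  have h1 : 1 / ((n : ℝ) + 1) ≤ 1 := by
    rw [div_le_one (by positivity)]
    linarith [(Nat.cast_nonneg n : (0 : ℝ) ≤ n)]
  nlinarith [abs_nonneg s, sq_abs s]

theorem tendsto_smoothAbs (s : ℝ) : Tendsto (fun n => smoothAbs n s) atTop (𝓝 |s|) := by
  have h := (tendsto_one_div_add_atTop_nhds_zero_nat (𝕜 := ℝ)).const_add (s ^ 2)
  rw [add_zero] at h
  have h2 := (Real.continuous_sqrt.tendsto _).comp h
  rwa [Real.sqrt_sq_eq_abs] at h2

theorem contDiff_smoothAbs (n : ℕ) : ContDiff ℝ 1 (smoothAbs n) :=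
  ContDiff.sqrt (by fun_prop) fun s => (smoothAbs_arg_pos n s).ne'

theorem hasDerivAt_smoothAbs (n : ℕ) (s : ℝ) : HasDerivAt (smoothAbs n) (s / smoothAbs n s) s := by
  have h := ((hasDerivAt_pow 2 s).add_const (1 / ((n : ℝ) + 1))).sqrt (smoothAbs_arg_pos n s).ne'
  refine h.congr_deriv ?_
  rw [smoothAbs, Nat.add_one_sub_one, Nat.cast_ofNat, pow_one, mul_div_mul_left _ _ (by norm_num : (2 : ℝ) ≠ 0)]

theorem tendsto_deriv_smoothAbs (s : ℝ) :
    Tendsto (fun n => s / smoothAbs n s) atTop (𝓝 (s / |s|)) := by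
  rcases eq_or_ne s 0 with rfl | hs
  -- At 0 both sides are 0, since 0 / 0 = 0; this convention fixes the value of the limiting sign
  -- function there.
  · simp
  · exact tendsto_const_nhds.div (tendsto_smoothAbs s) (abs_ne_zero.2 hs)

theorem abs_deriv_smoothAbs_sub_le (n : ℕ) (s : ℝ) : |s / smoothAbs n s - (s / |s|)| ≤ 2 := by
  have h1 : |s / smoothAbs n s| ≤ 1 := by
    rw [abs_div, abs_of_pos (smoothAbs_pos n s), div_le_one (smoothAbs_pos n s)]
    exact abs_le_smoothAbs n s
  have h2 : |(s / |s|)| ≤ 1 := by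
    rw [abs_div, abs_abs]
    exact div_self_le_one _
  calc _ ≤ |s / smoothAbs n s| + |(s / |s|)| := abs_sub _ _
    _ ≤ 2 := by linarith

/-- The functions √((l − c)² + 1/(n + 1)) are smooth, and they and their gradients converge
boundedly, hence in L². Taking l to be either coordinate provides the building blocks of the
trapezoids. -/
theorem exists_hasTrace_abs (l : ℝ × ℝ →L[ℝ] ℝ) (c : ℝ) :
    ∃ u : H1, HasTrace u fun z => |l z - c| := by
  have hl : Continuous fun z => l z - c := by fun_prop
  have hsm : ∀ n, Continuous fun z => smoothAbs n (l z - c) :=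
    fun n => (contDiff_smoothAbs n).continuous.comp hl
  have hφ : ∀ n, ContDiff ℝ 1 fun z => smoothAbs n (l z - c) := fun n =>
    (contDiff_smoothAbs n).comp (l.contDiff.sub contDiff_const)
  have hd : ∀ n z e, fderiv ℝ (fun z => smoothAbs n (l z - c)) z e
      = (l z - c) / smoothAbs n (l z - c) * l e := by
    intro n z e
    have h1 : HasFDerivAt (fun z => l z - c) l z := l.hasFDerivAt.sub_const c
    have h := (hasDerivAt_smoothAbs n (l z - c)).comp_hasFDerivAt z h1
    refine (congrArg (fun L : ℝ × ℝ →L[ℝ] ℝ => L e) h.fderiv).trans ?_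
    simp
  have hmd : ∀ e, Measurable fun z => (l z - c) / |l z - c| * l e := fun e =>
    (hl.measurable.div hl.abs.measurable).mul_const _
  have hLp : ∀ e, MemLp (fun z => (l z - c) / |l z - c| * l e) 2 muOmega := fun e => by
    refine MemLp.of_bound (hmd e).aestronglyMeasurable ‖l e‖ (ae_of_all _ fun z => ?_)
    rw [norm_mul, norm_div, Real.norm_eq_abs (|l z - c|), abs_abs, Real.norm_eq_abs (l z - c)]
    exact mul_le_of_le_one_left (norm_nonneg _) (div_self_le_one _)
  have t0 : Tendsto (fun n => eLpNorm (fun z => smoothAbs n (l z - c) - |l z - c|) 2 muOmega)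
      atTop (𝓝 0) := by
    refine tendsto_eLpNorm_of_bounded (M := 1) (fun n => (hsm n).measurable) hl.abs.measurable
      (fun n z => ?_) fun z => tendsto_smoothAbs _
    rw [abs_of_nonneg (sub_nonneg.2 (abs_le_smoothAbs _ _))]
    linarith [smoothAbs_le n (l z - c)]
  have td : ∀ e, Tendsto (fun n => eLpNorm (fun z => fderiv ℝ (fun z => smoothAbs n (l z - c)) z e
      - (l z - c) / |l z - c| * l e) 2 muOmega) atTop (𝓝 0) := by
    intro e
    refine tendsto_eLpNorm_of_bounded (M := 2 * |l e|)
      (fun n => (continuous_fderiv_apply (hφ n) e).measurable) (hmd e) (fun n z => ?_) fun z => ?_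
    · rw [hd, ← sub_mul, abs_mul]
      gcongr
      exact abs_deriv_smoothAbs_sub_le _ _
    · simp only [hd]
      exact (tendsto_deriv_smoothAbs _).mul_const _
  have ta : ∀ ι : ℝ → ℝ × ℝ, Continuous ι → Tendsto (fun n => eLpNorm (fun t =>
      smoothAbs n (l (ι t) - c) - |l (ι t) - c|) 2 muI) atTop (𝓝 0) := by
    intro ι hι
    refine tendsto_eLpNorm_of_bounded (M := 1) (fun n => ((hsm n).comp hι).measurable)
      (hl.abs.comp hι).measurable (fun n z => ?_) fun z => tendsto_smoothAbs _
    rw [abs_of_nonneg (sub_nonneg.2 (abs_le_smoothAbs _ _))]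
    linarith [smoothAbs_le n (l (ι z) - c)]
  have h0 := memLp_two_muOmega hl.abs
  refine ⟨⟨_, mem_H1_of_tendsto hφ h0 (hLp _) (hLp _) t0 (td _) (td _)⟩, _, hφ, ?_, ?_, ?_,
    fun s _ => ⟨ta _ (by fun_prop), ta _ (by fun_prop)⟩⟩
  · refine t0.congr fun n => eLpNorm_congr_ae ?_
    filter_upwards [h0.coeFn_toLp] with z hz
    exact congrArg (smoothAbs n (l z - c) - ·) hz.symm
  · refine (td (1, 0)).congr fun n => eLpNorm_congr_ae ?_
    filter_upwards [(hLp (1, 0)).coeFn_toLp] with z hz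
    exact congrArg (fderiv ℝ (fun z => smoothAbs n (l z - c)) z (1, 0) - ·) hz.symm
  · refine (td (0, 1)).congr fun n => eLpNorm_congr_ae ?_
    filter_upwards [(hLp (0, 1)).coeFn_toLp] with z hz
    exact congrArg (fderiv ℝ (fun z => smoothAbs n (l z - c)) z (0, 1) - ·) hz.symm

/-- The trapezoid is piecewise linear with kinks only at ±(1 − ε), so it is an affine combination of
two absolute values. -/
theorem trapezoid_eq {ε t : ℝ} (hε : 0 < ε) (hε' : ε < 1 / 2) :
    trapezoid ε t = (1 - (|t - (-(1 - ε))| + |t - (1 - ε)|) / 2) / ε := by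
  rw [trapezoid]
  split_ifs with h1 h2
  · rw [abs_of_nonpos (by linarith), abs_of_nonpos (by linarith)]
    ring
  · rw [abs_of_nonneg (by linarith), abs_of_nonpos (by linarith)]
    field_simp
    ring
  · rw [abs_of_nonneg (by linarith), abs_of_nonneg (by linarith)]
    ring

theorem trapezoid_end {ε s : ℝ} (hε : 0 < ε) (hε' : ε < 1 / 2) (hs : s = 1 ∨ s = -1) :
    trapezoid ε s = 0 := by
  rcases hs with rfl | rfl
  · rw [trapezoid, if_neg (by linarith), if_neg (by linarith)]
    simp
  · rw [trapezoid, if_pos (by linarith)]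
    simp

theorem measurable_trapezoid (ε : ℝ) : Measurable (trapezoid ε) :=
  Measurable.ite measurableSet_Iic (by fun_prop)
    (Measurable.ite measurableSet_Iic (by fun_prop) (by fun_prop))

theorem bdryDatum_zero_zero (B C ε : ℝ) (z : ℝ × ℝ) [Decidable (z.1 = 1 ∨ z.1 = -1)] :
    bdryDatum B C ε z 0 0
      = B / (2 * C) * if z.1 = 1 ∨ z.1 = -1 then -trapezoid ε z.2 else trapezoid ε z.1 := by
  unfold bdryDatum
  split_ifs <;> simp

theorem bdryDatum_one_one (B C ε : ℝ) (z : ℝ × ℝ) :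
    bdryDatum B C ε z 1 1 = -bdryDatum B C ε z 0 0 := by
  unfold bdryDatum
  split_ifs <;> simp

theorem bdryDatum_zero_one (B C ε : ℝ) (z : ℝ × ℝ) : bdryDatum B C ε z 0 1 = 0 := by
  unfold bdryDatum
  split_ifs <;> simp

theorem bdryDatum_one_zero (B C ε : ℝ) (z : ℝ × ℝ) : bdryDatum B C ε z 1 0 = 0 := by
  unfold bdryDatum
  split_ifs <;> simp

theorem measurable_bdryDatum (B C ε : ℝ) (i j : Fin 2) :
    Measurable fun z => bdryDatum B C ε z i j := by
  classical
  have h00 : Measurable fun z => bdryDatum B C ε z 0 0 := by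
    simp only [bdryDatum_zero_zero]
    have hs : MeasurableSet {z : ℝ × ℝ | z.1 = 1 ∨ z.1 = -1} :=
      (measurable_fst (measurableSet_singleton 1)).union (measurable_fst (measurableSet_singleton (-1)))
    exact (Measurable.ite hs ((measurable_trapezoid ε).comp measurable_snd).neg
      ((measurable_trapezoid ε).comp measurable_fst)).const_mul _
  fin_cases i <;> fin_cases j
  · exact h00
  · simp [bdryDatum_zero_one]
  · simp [bdryDatum_one_zero]
  · simp only [Fin.mk_one, bdryDatum_one_one]
    exact h00.neg

theorem exists_hasTrace_bdryDatum (B C : ℝ) {ε : ℝ} (hε : 0 < ε) (hε' : ε < 1 / 2) :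
    ∃ u : H1, HasTrace u fun z => bdryDatum B C ε z 0 0 := by
  classical
  obtain ⟨x₁, hx₁⟩ := exists_hasTrace_abs (.fst ℝ ℝ ℝ) (-(1 - ε))
  obtain ⟨x₂, hx₂⟩ := exists_hasTrace_abs (.fst ℝ ℝ ℝ) (1 - ε)
  obtain ⟨y₁, hy₁⟩ := exists_hasTrace_abs (.snd ℝ ℝ ℝ) (-(1 - ε))
  obtain ⟨y₂, hy₂⟩ := exists_hasTrace_abs (.snd ℝ ℝ ℝ) (1 - ε)
  have hx := hx₁.linComb hx₂ (by fun_prop) (by fun_prop) 1 1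
  have hy := hy₁.linComb hy₂ (by fun_prop) (by fun_prop) 1 1
  -- The extension is (B/2C)(T(x) − T(y)): T vanishes at ±1, so on each side only the wanted term
  -- survives.
  have h := hx.linComb hy (by fun_prop) (by fun_prop) (-(B / (2 * C) / (2 * ε))) (B / (2 * C) / (2 * ε))
  refine ⟨_, h.congr fun s hs t _ => ?_⟩
  have es := trapezoid_eq (t := s) hε hε'
  have et := trapezoid_eq (t := t) hε hε'
  have e0 := trapezoid_end hε hε' hs
  have expand : ∀ a b c d : ℝ, -(B / (2 * C) / (2 * ε)) * (1 * a + 1 * b)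
      + B / (2 * C) / (2 * ε) * (1 * c + 1 * d)
      = B / (2 * C) * ((1 - (a + b) / 2) / ε - (1 - (c + d) / 2) / ε) := by
    intro a b c d
    field_simp
    ring
  simp only [ContinuousLinearMap.coe_fst', ContinuousLinearMap.coe_snd', expand, ← es, ← et, e0,
    bdryDatum_zero_zero]
  rw [if_pos hs]
  refine ⟨by ring, ?_⟩
  -- The first case is a corner, where the datum takes its other branch; both branches vanish there.
  split_ifs with h2
  · rw [trapezoid_end hε hε' h2]
    ring
  · ring

/-! ### Reduction to the two independent entries p and q. -/

/-- The symmetric traceless matrix with given first row. -/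
noncomputable def s0Matrix (p q : H1) : Matrix (Fin 2) (Fin 2) H1 := !![p, q; q, -p]

theorem s0Matrix_isS0Valued (p q : H1) : IsS0Valued (s0Matrix p q) := by
  constructor
  · refine Matrix.IsSymm.ext fun i j => ?_
    fin_cases i <;> fin_cases j <;> rfl
  · simp [s0Matrix, Matrix.trace_fin_two]

theorem IsS0Valued.one_one {P : Matrix (Fin 2) (Fin 2) H1} (h : IsS0Valued P) :
    P 1 1 = -P 0 0 := by
  have := h.2
  rw [Matrix.trace_fin_two] at this
  exact eq_neg_of_add_eq_zero_right this

theorem IsS0Valued.one_zero {P : Matrix (Fin 2) (Fin 2) H1} (h : IsS0Valued P) :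
    P 1 0 = P 0 1 := h.1.apply 0 1

theorem IsS0Valued.ext {P Q : Matrix (Fin 2) (Fin 2) H1} (hP : IsS0Valued P) (hQ : IsS0Valued Q)
    (h0 : P 0 0 = Q 0 0) (h1 : P 0 1 = Q 0 1) : P = Q := by
  ext1 i j
  fin_cases i <;> fin_cases j
  · exact h0
  · exact h1
  · exact hP.one_zero.trans (h1.trans hQ.one_zero.symm)
  · exact hP.one_one.trans ((congrArg _ h0).trans hQ.one_one.symm)

theorem s0Matrix_mem_admissible {B C ε : ℝ} {p q : H1}
    (hp : HasTrace p fun z => bdryDatum B C ε z 0 0) (hq : HasTrace q fun _ => 0) :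
    s0Matrix p q ∈ admissible B C ε := by
  refine ⟨s0Matrix_isS0Valued p q, fun i j => ?_⟩
  have hn := hp.linComb hasTrace_zero (measurable_bdryDatum B C ε 0 0) measurable_const (-1) 0
  rw [show (-1 : ℝ) • p + (0 : ℝ) • (0 : H1) = -p by module] at hn
  fin_cases i <;> fin_cases j
  · exact hp
  · simpa [bdryDatum_zero_one, s0Matrix] using hq
  · simpa [bdryDatum_one_zero, s0Matrix] using hq
  · simpa [bdryDatum_one_one, s0Matrix] using hn

/-! ### The energy as a quadratic plus a quartic form, and its behaviour on segments. -/

theorem norm_sq_segment {F : Type*} [NormedAddCommGroup F] [InnerProductSpace ℝ F] (u v : F)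
    (t : ℝ) : ‖u + t • (v - u)‖ ^ 2
      = (1 - t) * ‖u‖ ^ 2 + t * ‖v‖ ^ 2 - t * (1 - t) * ‖v - u‖ ^ 2 := by
  rw [norm_add_sq_real, norm_smul, mul_pow, norm_sub_sq_real, inner_smul_right, inner_sub_right,
    real_inner_self_eq_norm_sq, real_inner_comm, Real.norm_eq_abs, sq_abs]
  ring

theorem norm_sq_line {F : Type*} [NormedAddCommGroup F] [InnerProductSpace ℝ F] (u v : F)
    (t : ℝ) : ‖u + t • v‖ ^ 2 = ‖u‖ ^ 2 + 2 * t * inner ℝ u v + t ^ 2 * ‖v‖ ^ 2 := by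
  rw [norm_add_sq_real, norm_smul, mul_pow, inner_smul_right, Real.norm_eq_abs, sq_abs]
  ring

theorem L2.norm_sq_eq_integral (u : L2) : ‖u‖ ^ 2 = ∫ z, u z ^ 2 ∂muOmega := by
  rw [← real_inner_self_eq_norm_sq, MeasureTheory.L2.inner_def]
  refine integral_congr_ae (ae_of_all _ fun z => ?_)
  simp [pow_two]

theorem L2.integrable_sq (u : L2) : Integrable (fun z => u z ^ 2) muOmega :=
  (Lp.memLp u).integrable_sq

theorem L2.coeFn_add_smul (u v : L2) (t : ℝ) :
    (u + t • v : L2) =ᵐ[muOmega] fun z => u z + t * v z := by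
  filter_upwards [L2.coeFn_linComb 1 t u v] with z hz
  rw [one_smul, one_mul] at hz
  exact hz

/-- The quadratic part of the energy of a scalar component. -/
noncomputable def quadEnergy (κ b : ℝ) (u : H1) : ℝ :=
  1 / b ^ 2 * ‖H1.dx u‖ ^ 2 + ‖H1.dy u‖ ^ 2 - κ * ‖H1.val u‖ ^ 2

/-- The quartic part of the energy, `∫ (p² + q²)²`. -/
noncomputable def quarticEnergy (p q : H1) : ℝ :=
  ∫ z, (H1.val p z ^ 2 + H1.val q z ^ 2) ^ 2 ∂muOmega

/-- The energy in terms of the two independent components of the order parameter. -/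
noncomputable def pairEnergy (κ b lam : ℝ) (p q : H1) : ℝ :=
  quadEnergy κ b p + quadEnergy κ b q + lam ^ 2 / 2 * quarticEnergy p q

theorem integrable_quartic {p q : H1} (hp : MemLp (H1.val p) 4 muOmega)
    (hq : MemLp (H1.val q) 4 muOmega) :
    Integrable (fun z => (H1.val p z ^ 2 + H1.val q z ^ 2) ^ 2) muOmega := by
  have h4 : ∀ {u : H1}, MemLp (H1.val u) 4 muOmega →
      Integrable (fun z => H1.val u z ^ 4) muOmega := fun {u} h => by
    have := h.integrable_norm_pow (p := 4) (by norm_num)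
    refine this.congr (ae_of_all _ fun z => ?_)
    have e : (4 : ℕ) = 2 * 2 := rfl
    simp only [Real.norm_eq_abs]
    rw [e, pow_mul, sq_abs, ← pow_mul]
  refine (((h4 hp).const_mul 2).add ((h4 hq).const_mul 2)).mono' ?_ (ae_of_all _ fun z => ?_)
  · exact (((L2.aesm _).pow 2).add ((L2.aesm _).pow 2)).pow 2
  · rw [Real.norm_eq_abs, abs_of_nonneg (by positivity), Pi.add_apply]
    nlinarith [sq_nonneg (H1.val p z ^ 2 - H1.val q z ^ 2)]

theorem memLp_four_add_smul {u v : H1} (hu : MemLp (H1.val u) 4 muOmega)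
    (hv : MemLp (H1.val v) 4 muOmega) (t : ℝ) : MemLp (H1.val (u + t • v)) 4 muOmega := by
  refine (hu.add (hv.const_mul t)).ae_eq ?_
  filter_upwards [L2.coeFn_add_smul (H1.val u) (H1.val v) t] with z hz
  exact hz.symm

theorem integral_add_add_sub_add {α : Type*} [MeasurableSpace α] {μ : Measure α}
    {f₁ f₂ f₃ f₄ : α → ℝ} (h₁ : Integrable f₁ μ) (h₂ : Integrable f₂ μ) (h₃ : Integrable f₃ μ)
    (h₄ : Integrable f₄ μ) : ∫ z, (f₁ z + f₂ z - f₃ z + f₄ z) ∂μ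
      = ∫ z, f₁ z ∂μ + ∫ z, f₂ z ∂μ - ∫ z, f₃ z ∂μ + ∫ z, f₄ z ∂μ := by
  rw [integral_add (f := fun z => f₁ z + f₂ z - f₃ z) ((h₁.add h₂).sub h₃) h₄,
    integral_sub (f := fun z => f₁ z + f₂ z) (h₁.add h₂) h₃, integral_add h₁ h₂]

theorem integral_linComb_five {α : Type*} [MeasurableSpace α] {μ : Measure α}
    {f₁ f₂ f₃ f₄ f₅ : α → ℝ} (h₁ : Integrable f₁ μ) (h₂ : Integrable f₂ μ) (h₃ : Integrable f₃ μ)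
    (h₄ : Integrable f₄ μ) (h₅ : Integrable f₅ μ) (c₁ c₂ c₃ c₄ c₅ : ℝ) :
    ∫ z, (c₁ * f₁ z + c₂ * f₂ z + c₃ * f₃ z + c₄ * f₄ z + c₅ * f₅ z) ∂μ
      = c₁ * ∫ z, f₁ z ∂μ + c₂ * ∫ z, f₂ z ∂μ + c₃ * ∫ z, f₃ z ∂μ + c₄ * ∫ z, f₄ z ∂μ
        + c₅ * ∫ z, f₅ z ∂μ := by
  have i₁ := h₁.const_mul c₁
  have i₂ := h₂.const_mul c₂
  have i₃ := h₃.const_mul c₃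
  have i₄ := h₄.const_mul c₄
  rw [integral_add (f := fun z => c₁ * f₁ z + c₂ * f₂ z + c₃ * f₃ z + c₄ * f₄ z)
      (((i₁.add i₂).add i₃).add i₄) (h₅.const_mul c₅),
    integral_add (f := fun z => c₁ * f₁ z + c₂ * f₂ z + c₃ * f₃ z) ((i₁.add i₂).add i₃) i₄,
    integral_add (f := fun z => c₁ * f₁ z + c₂ * f₂ z) (i₁.add i₂) i₃, integral_add i₁ i₂]
  simp only [integral_const_mul]

/-- Here |P|² = 2(p² + q²), which turns the coefficients of the energy into 1/b², 1, −κ and λ²/2.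
The L⁴ hypotheses give integrability, so that the integral may be split. -/
theorem energy_eq_pairEnergy {B C b lam : ℝ} (hC : C ≠ 0) {P : Matrix (Fin 2) (Fin 2) H1}
    (hP : IsS0Valued P) (h0 : MemLp (H1.val (P 0 0)) 4 muOmega)
    (h1 : MemLp (H1.val (P 0 1)) 4 muOmega) :
    energy B C b lam P = pairEnergy (lam ^ 2 * B ^ 2 / (4 * C ^ 2)) b lam (P 0 0) (P 0 1) := by
  set κ := lam ^ 2 * B ^ 2 / (4 * C ^ 2) with hκ
  have hsum : ∀ u v : L2, Integrable (fun z => u z ^ 2 + v z ^ 2) muOmega ∧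
      ∫ z, (u z ^ 2 + v z ^ 2) ∂muOmega = ‖u‖ ^ 2 + ‖v‖ ^ 2 := fun u v =>
    ⟨(L2.integrable_sq u).add (L2.integrable_sq v), by
      rw [integral_add (L2.integrable_sq u) (L2.integrable_sq v), L2.norm_sq_eq_integral,
        L2.norm_sq_eq_integral]⟩
  have hr := (integrable_quartic h0 h1).const_mul (lam ^ 2 / 2)
  have key : energy B C b lam P = ∫ z, (1 / b ^ 2 * (H1.dx (P 0 0) z ^ 2 + H1.dx (P 0 1) z ^ 2)
      + (H1.dy (P 0 0) z ^ 2 + H1.dy (P 0 1) z ^ 2)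
      - κ * (H1.val (P 0 0) z ^ 2 + H1.val (P 0 1) z ^ 2)
      + lam ^ 2 / 2 * (H1.val (P 0 0) z ^ 2 + H1.val (P 0 1) z ^ 2) ^ 2) ∂muOmega := by
    refine integral_congr_ae ?_
    filter_upwards [Lp.coeFn_neg (H1.dx (P 0 0)), Lp.coeFn_neg (H1.dy (P 0 0)),
      Lp.coeFn_neg (H1.val (P 0 0))] with z h1 h2 h3
    have h1' : H1.dx (-P 0 0) z = -H1.dx (P 0 0) z := h1
    have h2' : H1.dy (-P 0 0) z = -H1.dy (P 0 0) z := h2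
    have h3' : H1.val (-P 0 0) z = -H1.val (P 0 0) z := h3
    simp only [normSq, Matrix.trace_fin_two, Matrix.mul_apply, Fin.sum_univ_two, Matrix.of_apply,
      hP.one_one, hP.one_zero, h1', h2', h3', hκ]
    field_simp
    ring
  rw [key, integral_add_add_sub_add ((hsum _ _).1.const_mul _) (hsum _ _).1
    ((hsum _ _).1.const_mul _) hr, integral_const_mul, integral_const_mul, integral_const_mul,
    (hsum _ _).2, (hsum _ _).2, (hsum _ _).2]
  simp only [pairEnergy, quadEnergy, quarticEnergy]
  ring

/-- An identity, so the convexity defect is exactly the form evaluated at v − u. When v − u has zero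
trace, its sign is a matter of coercivity. -/
theorem quadEnergy_segment (κ b : ℝ) (u v : H1) (t : ℝ) :
    quadEnergy κ b (u + t • (v - u))
      = (1 - t) * quadEnergy κ b u + t * quadEnergy κ b v
        - t * (1 - t) * quadEnergy κ b (v - u) := by
  have h0 : ‖H1.val (u + t • (v - u))‖ ^ 2 = (1 - t) * ‖H1.val u‖ ^ 2 + t * ‖H1.val v‖ ^ 2
      - t * (1 - t) * ‖H1.val (v - u)‖ ^ 2 := norm_sq_segment (H1.val u) (H1.val v) t
  have h1 : ‖H1.dx (u + t • (v - u))‖ ^ 2 = (1 - t) * ‖H1.dx u‖ ^ 2 + t * ‖H1.dx v‖ ^ 2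
      - t * (1 - t) * ‖H1.dx (v - u)‖ ^ 2 := norm_sq_segment (H1.dx u) (H1.dx v) t
  have h2 : ‖H1.dy (u + t • (v - u))‖ ^ 2 = (1 - t) * ‖H1.dy u‖ ^ 2 + t * ‖H1.dy v‖ ^ 2
      - t * (1 - t) * ‖H1.dy (v - u)‖ ^ 2 := norm_sq_segment (H1.dy u) (H1.dy v) t
  rw [quadEnergy, h0, h1, h2]
  simp only [quadEnergy]
  ring

theorem differentiable_quadEnergy_line (κ b : ℝ) (u v : H1) :
    Differentiable ℝ fun t : ℝ => quadEnergy κ b (u + t • v) := by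
  have h : (fun t : ℝ => quadEnergy κ b (u + t • v)) = fun t =>
      1 / b ^ 2 * (‖H1.dx u‖ ^ 2 + 2 * t * inner ℝ (H1.dx u) (H1.dx v) + t ^ 2 * ‖H1.dx v‖ ^ 2)
      + (‖H1.dy u‖ ^ 2 + 2 * t * inner ℝ (H1.dy u) (H1.dy v) + t ^ 2 * ‖H1.dy v‖ ^ 2)
      - κ * (‖H1.val u‖ ^ 2 + 2 * t * inner ℝ (H1.val u) (H1.val v)
        + t ^ 2 * ‖H1.val v‖ ^ 2) := by
    ext t
    rw [← norm_sq_line, ← norm_sq_line, ← norm_sq_line]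
    rfl
  rw [h]
  fun_prop

/-- Pointwise convexity: s ↦ s² is convex and increasing on s ≥ 0, and it is composed with the
convex function a² + c². -/
theorem quarticEnergy_segment_le {p q p' q' : H1} (hp : MemLp (H1.val p) 4 muOmega)
    (hq : MemLp (H1.val q) 4 muOmega) (hp' : MemLp (H1.val p') 4 muOmega)
    (hq' : MemLp (H1.val q') 4 muOmega) {t : ℝ} (ht : t ∈ Icc (0 : ℝ) 1) :
    quarticEnergy (p + t • (p' - p)) (q + t • (q' - q))
      ≤ (1 - t) * quarticEnergy p q + t * quarticEnergy p' q' := by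
  have hd : ∀ {u v : H1}, MemLp (H1.val u) 4 muOmega → MemLp (H1.val v) 4 muOmega →
      MemLp (H1.val (v - u)) 4 muOmega := fun {u v} hu hv =>
    (hv.sub hu).ae_eq (Lp.coeFn_sub (H1.val v) (H1.val u)).symm
  simp only [quarticEnergy]
  rw [← integral_const_mul, ← integral_const_mul,
    ← integral_add ((integrable_quartic hp hq).const_mul _) ((integrable_quartic hp' hq').const_mul _)]
  refine integral_mono_ae (integrable_quartic (memLp_four_add_smul hp (hd hp hp') t)
    (memLp_four_add_smul hq (hd hq hq') t))
    (((integrable_quartic hp hq).const_mul _).add ((integrable_quartic hp' hq').const_mul _)) ?_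
  filter_upwards [L2.coeFn_add_smul (H1.val p) (H1.val p' - H1.val p) t,
    L2.coeFn_add_smul (H1.val q) (H1.val q' - H1.val q) t,
    Lp.coeFn_sub (H1.val p') (H1.val p), Lp.coeFn_sub (H1.val q') (H1.val q)] with z h1 h2 h3 h4
  have h1' : H1.val (p + t • (p' - p)) z = H1.val p z + t * (H1.val p' z - H1.val p z) :=
    h1.trans (by rw [h3]; rfl)
  have h2' : H1.val (q + t • (q' - q)) z = H1.val q z + t * (H1.val q' z - H1.val q z) :=
    h2.trans (by rw [h4]; rfl)
  rw [h1', h2']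
  generalize H1.val p z = a
  generalize H1.val q z = c
  generalize H1.val p' z = a'
  generalize H1.val q' z = c'
  obtain ⟨ht0, ht1⟩ := ht
  have hs : 0 ≤ t * (1 - t) := mul_nonneg ht0 (by linarith)
  have e1 : (a + t * (a' - a)) ^ 2 + (c + t * (c' - c)) ^ 2
      = (1 - t) * (a ^ 2 + c ^ 2) + t * (a' ^ 2 + c' ^ 2)
        - t * (1 - t) * ((a' - a) ^ 2 + (c' - c) ^ 2) := by ring
  have e2 : (a + t * (a' - a)) ^ 2 + (c + t * (c' - c)) ^ 2
      ≤ (1 - t) * (a ^ 2 + c ^ 2) + t * (a' ^ 2 + c' ^ 2) := by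
    rw [e1]
    have := mul_nonneg hs (by positivity : 0 ≤ (a' - a) ^ 2 + (c' - c) ^ 2)
    linarith
  calc _ ≤ ((1 - t) * (a ^ 2 + c ^ 2) + t * (a' ^ 2 + c' ^ 2)) ^ 2 :=
        pow_le_pow_left₀ (by positivity) e2 2
    _ = (1 - t) * (a ^ 2 + c ^ 2) ^ 2 + t * (a' ^ 2 + c' ^ 2) ^ 2
        - t * (1 - t) * ((a ^ 2 + c ^ 2) - (a' ^ 2 + c' ^ 2)) ^ 2 := by ring
    _ ≤ _ := by
        have := mul_nonneg hs (sq_nonneg ((a ^ 2 + c ^ 2) - (a' ^ 2 + c' ^ 2)))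
        linarith

theorem differentiable_quarticEnergy_line {p q φ ψ : H1} (hp : MemLp (H1.val p) 4 muOmega)
    (hq : MemLp (H1.val q) 4 muOmega) (hφ : MemLp (H1.val φ) 4 muOmega)
    (hψ : MemLp (H1.val ψ) 4 muOmega) :
    Differentiable ℝ fun t : ℝ => quarticEnergy (p + t • φ) (q + t • ψ) := by
  have hi : ∀ t : ℝ, Integrable (fun z => (H1.val (p + t • φ) z ^ 2
      + H1.val (q + t • ψ) z ^ 2) ^ 2) muOmega := fun t =>
    integrable_quartic (memLp_four_add_smul hp hφ t) (memLp_four_add_smul hq hψ t)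
  set R : ℝ → ℝ := fun t => quarticEnergy (p + t • φ) (q + t • ψ) with hR
  -- Pointwise the integrand is a polynomial of degree at most 4 in t, so Lagrange interpolation at
  -- −2, −1, 0, 1, 2 recovers R from five of its values. Differentiability then needs no
  -- differentiation under the integral.
  have h : R = fun t => t * (t ^ 2 - 1) * (t - 2) / 24 * R (-2)
      + -(t * (t - 1) * (t ^ 2 - 4)) / 6 * R (-1) + (t ^ 2 - 1) * (t ^ 2 - 4) / 4 * R 0
      + -(t * (t + 1) * (t ^ 2 - 4)) / 6 * R 1 + t * (t ^ 2 - 1) * (t + 2) / 24 * R 2 := by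
    ext t
    simp only [hR, quarticEnergy]
    rw [← integral_linComb_five (hi (-2)) (hi (-1)) (hi 0) (hi 1) (hi 2)]
    have hc : ∀ s : ℝ, ∀ᵐ z ∂muOmega, H1.val (p + s • φ) z = H1.val p z + s * H1.val φ z ∧
        H1.val (q + s • ψ) z = H1.val q z + s * H1.val ψ z := fun s => by
      filter_upwards [L2.coeFn_add_smul (H1.val p) (H1.val φ) s,
        L2.coeFn_add_smul (H1.val q) (H1.val ψ) s] with z h1 h2
      exact ⟨h1, h2⟩
    refine integral_congr_ae ?_
    filter_upwards [hc t, hc (-2), hc (-1), hc 0, hc 1, hc 2] with z h h1 h2 h3 h4 h5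
    rw [h.1, h.2, h1.1, h1.2, h2.1, h2.2, h3.1, h3.2, h4.1, h4.2, h5.1, h5.2]
    ring
  rw [h]
  fun_prop

/-- Fatou's lemma along a subsequence on which both components converge almost everywhere;
continuity of the quartic term on H¹ is not needed. -/
theorem quarticEnergy_le_of_tendsto {p q : ℕ → H1} {p' q' : H1} {k L : ℝ} (hk : 0 ≤ k)
    (hp : ∀ n, MemLp (H1.val (p n)) 4 muOmega) (hq : ∀ n, MemLp (H1.val (q n)) 4 muOmega)
    (hp' : MemLp (H1.val p') 4 muOmega) (hq' : MemLp (H1.val q') 4 muOmega)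
    (tp : Tendsto p atTop (𝓝 p')) (tq : Tendsto q atTop (𝓝 q'))
    (tL : Tendsto (fun n => k * quarticEnergy (p n) (q n)) atTop (𝓝 L)) :
    k * quarticEnergy p' q' ≤ L := by
  have hval : Continuous H1.val := continuous_fst.comp continuous_subtype_val
  have vp := (hval.tendsto p').comp tp
  have vq := (hval.tendsto q').comp tq
  -- The second extraction is made inside the first, so that one subsequence serves both components.
  obtain ⟨ns, hns, h1⟩ := (tendstoInMeasure_of_tendsto_Lp vp).exists_seq_tendsto_ae
  obtain ⟨ms, hms, h2⟩ :=
    (tendstoInMeasure_of_tendsto_Lp (vq.comp hns.tendsto_atTop)).exists_seq_tendsto_ae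
  have L0 : 0 ≤ L := ge_of_tendsto' tL fun n =>
    mul_nonneg hk (integral_nonneg fun z => by positivity)
  have conv : ∀ {u v : H1}, MemLp (H1.val u) 4 muOmega → MemLp (H1.val v) 4 muOmega →
      ENNReal.ofReal (k * quarticEnergy u v)
        = ∫⁻ z, ENNReal.ofReal (k * (H1.val u z ^ 2 + H1.val v z ^ 2) ^ 2) ∂muOmega := by
    intro u v hu hv
    rw [quarticEnergy, ← integral_const_mul]
    exact ofReal_integral_eq_lintegral_ofReal ((integrable_quartic hu hv).const_mul k)
      (ae_of_all _ fun z => by positivity)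
  have t1 : Tendsto (fun j => ENNReal.ofReal (k * quarticEnergy (p (ns (ms j))) (q (ns (ms j)))))
      atTop (𝓝 (ENNReal.ofReal L)) := ENNReal.tendsto_ofReal (tL.comp (hns.comp hms).tendsto_atTop)
  have fatou := lintegral_liminf_le' (μ := muOmega) (u := atTop)
    (f := fun j z => ENNReal.ofReal (k * (H1.val (p (ns (ms j))) z ^ 2
      + H1.val (q (ns (ms j))) z ^ 2) ^ 2)) fun j =>
        ((integrable_quartic (hp _) (hq _)).const_mul k).aemeasurable.ennreal_ofReal
  simp only [← conv (hp _) (hq _)] at fatou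
  rw [t1.liminf_eq] at fatou
  rw [← ENNReal.ofReal_le_ofReal_iff L0, conv hp' hq']
  refine le_trans (le_of_eq (lintegral_congr_ae ?_)) fatou
  filter_upwards [h1, h2] with z z1 z2
  have z1' := z1.comp hms.tendsto_atTop
  have := ENNReal.tendsto_ofReal ((((z1'.pow 2).add (z2.pow 2)).pow 2).const_mul k)
  exact this.liminf_eq.symm

/-! ### Coercivity, lower bounds and existence of a minimizer. -/

/-- Coercivity of the quadratic part on functions of zero trace. -/
theorem quadEnergy_coercive {κ b : ℝ} (hκ : κ < 1 / 16) (hb : 1 < b) {u : H1}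
    (hu : HasTrace u fun _ => 0) : 1 / (32 * b ^ 2) * ‖u‖ ^ 2 ≤ quadEnergy κ b u := by
  have hP := hu.poincare
  have hb2 : (1 : ℝ) ≤ b ^ 2 := one_le_pow₀ hb.le
  have hnorm : ‖u‖ ^ 2 ≤ ‖H1.val u‖ ^ 2 + ‖H1.dx u‖ ^ 2 + ‖H1.dy u‖ ^ 2 := by
    -- The norm on `H1` is the maximum of the three L² norms, inherited from the product.
    have e : ‖u‖ = max ‖H1.val u‖ (max ‖H1.dx u‖ ‖H1.dy u‖) := rfl
    rw [e]
    have a1 := sq_nonneg ‖H1.val u‖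
    have a2 := sq_nonneg ‖H1.dx u‖
    have a3 := sq_nonneg ‖H1.dy u‖
    rcases max_choice ‖H1.val u‖ (max ‖H1.dx u‖ ‖H1.dy u‖) with h | h <;> rw [h]
    · linarith
    · rcases max_choice ‖H1.dx u‖ ‖H1.dy u‖ with h | h <;> rw [h] <;> linarith
  -- Poincaré absorbs (1/32 + 1/16)‖u‖² into (3/4)‖u_y‖²; adding (1/32)‖u_y‖² still leaves a
  -- coefficient below 1. The factor b² in the constant pays for the weak x-derivative term.
  have hc : 1 / (32 * b ^ 2) ≤ 1 / 32 := one_div_le_one_div_of_le (by norm_num) (by linarith)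
  have hc2 : 1 / (32 * b ^ 2) ≤ 1 / b ^ 2 := one_div_le_one_div_of_le (by positivity) (by linarith)
  have hc0 : 0 ≤ 1 / (32 * b ^ 2) := by positivity
  have h1 : 1 / (32 * b ^ 2) * ‖H1.val u‖ ^ 2 ≤ 1 / 32 * ‖H1.val u‖ ^ 2 := by gcongr
  have h2 : 1 / (32 * b ^ 2) * ‖H1.dx u‖ ^ 2 ≤ 1 / b ^ 2 * ‖H1.dx u‖ ^ 2 := by gcongr
  have h3 : 1 / (32 * b ^ 2) * ‖H1.dy u‖ ^ 2 ≤ 1 / 32 * ‖H1.dy u‖ ^ 2 := by gcongr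
  have h4 : κ * ‖H1.val u‖ ^ 2 ≤ 1 / 16 * ‖H1.val u‖ ^ 2 := by gcongr
  have h5 := mul_le_mul_of_nonneg_left hnorm hc0
  have h6 := sq_nonneg ‖H1.dy u‖
  rw [quadEnergy]
  linarith

/-- Completing the square: λ²(r − m)² ≥ 0 with r = p² + q². Writing κ as λ²m keeps the case λ = 0
covered without any division. -/
theorem pairEnergy_bddBelow (b lam m : ℝ) : ∃ K : ℝ, ∀ p q : H1,
    MemLp (H1.val p) 4 muOmega → MemLp (H1.val q) 4 muOmega →
      K ≤ pairEnergy (lam ^ 2 * m) b lam p q := by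
  refine ⟨-∫ _, lam ^ 2 * m ^ 2 / 2 ∂muOmega, fun p q hp hq => ?_⟩
  have hs := (L2.integrable_sq (H1.val p)).add (L2.integrable_sq (H1.val q))
  have hr := (integrable_quartic hp hq).const_mul (lam ^ 2 / 2)
  have hc : Integrable (fun _ : ℝ × ℝ => lam ^ 2 * m ^ 2 / 2) muOmega := integrable_const _
  have h : ∫ z, lam ^ 2 * m * (H1.val p z ^ 2 + H1.val q z ^ 2) ∂muOmega
      ≤ ∫ z, (lam ^ 2 / 2 * (H1.val p z ^ 2 + H1.val q z ^ 2) ^ 2 + lam ^ 2 * m ^ 2 / 2)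
        ∂muOmega := by
    refine integral_mono (hs.const_mul _) (hr.add hc) fun z => ?_
    have := mul_nonneg (sq_nonneg lam) (sq_nonneg (H1.val p z ^ 2 + H1.val q z ^ 2 - m))
    dsimp only
    linarith
  rw [integral_add hr hc, integral_const_mul, integral_const_mul,
    integral_add (L2.integrable_sq _) (L2.integrable_sq _), ← L2.norm_sq_eq_integral,
    ← L2.norm_sq_eq_integral] at h
  have h1 : 0 ≤ 1 / b ^ 2 * ‖H1.dx p‖ ^ 2 := by positivity
  have h2 : 0 ≤ 1 / b ^ 2 * ‖H1.dx q‖ ^ 2 := by positivity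
  have h3 := sq_nonneg ‖H1.dy p‖
  have h4 := sq_nonneg ‖H1.dy q‖
  simp only [pairEnergy, quadEnergy]
  change _ ≤ lam ^ 2 / 2 * quarticEnergy p q + _ at h
  linarith

theorem continuous_quadEnergy (κ b : ℝ) : Continuous (quadEnergy κ b) := by
  have hval : Continuous H1.val := continuous_fst.comp continuous_subtype_val
  have hdx : Continuous H1.dx := (continuous_fst.comp continuous_snd).comp continuous_subtype_val
  have hdy : Continuous H1.dy := (continuous_snd.comp continuous_snd).comp continuous_subtype_val
  unfold quadEnergy
  fun_prop

theorem pairEnergy_segment_le (κ b lam : ℝ) {p q p' q' : H1} (hp : MemLp (H1.val p) 4 muOmega)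
    (hq : MemLp (H1.val q) 4 muOmega) (hp' : MemLp (H1.val p') 4 muOmega)
    (hq' : MemLp (H1.val q') 4 muOmega) {t : ℝ} (ht : t ∈ Icc (0 : ℝ) 1) :
    pairEnergy κ b lam (p + t • (p' - p)) (q + t • (q' - q))
      ≤ (1 - t) * pairEnergy κ b lam p q + t * pairEnergy κ b lam p' q'
        - t * (1 - t) * (quadEnergy κ b (p' - p) + quadEnergy κ b (q' - q)) := by
  have h := mul_le_mul_of_nonneg_left (quarticEnergy_segment_le hp hq hp' hq' ht)
    (by positivity : 0 ≤ lam ^ 2 / 2)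
  simp only [pairEnergy, quadEnergy_segment]
  linarith

theorem HasTrace.add_smul {u φ : H1} {g : ℝ × ℝ → ℝ} (hu : HasTrace u g)
    (hφ : HasTrace φ fun _ => 0) (hg : Measurable g) (t : ℝ) : HasTrace (u + t • φ) g := by
  have h := hu.linComb hφ hg measurable_const 1 t
  rw [show (1 : ℝ) • u + t • φ = u + t • φ by module] at h
  simpa using h

theorem HasTrace.sub {u v : H1} {g : ℝ × ℝ → ℝ} (hu : HasTrace u g) (hv : HasTrace v g)
    (hg : Measurable g) : HasTrace (v - u) fun _ => 0 := by
  have h := hv.linComb hu hg hg 1 (-1)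
  rw [show (1 : ℝ) • v + (-1 : ℝ) • u = v - u by module] at h
  simpa using h

theorem HasTrace.neg {u : H1} (hu : HasTrace u fun _ => 0) : HasTrace (-u) fun _ => 0 := by
  have h := hasTrace_zero.add_smul hu measurable_const (-1)
  rwa [show (0 : H1) + (-1 : ℝ) • u = -u by module] at h

theorem HasTrace.memLp_four_of_measurable {u : H1} {g : ℝ × ℝ → ℝ} (h : HasTrace u g)
    (hg : Measurable g) : MemLp (H1.val u) 4 muOmega :=
  h.memLp_four (h.memLp_left hg) (h.memLp_bottom hg)

/-- A sequence whose squared mutual distances are bounded by a null sequence is Cauchy. -/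
theorem cauchySeq_of_norm_sub_sq_le {F : Type*} [NormedAddCommGroup F] {u : ℕ → F} {e : ℕ → ℝ}
    {c : ℝ} (hc : 0 < c) (he : Tendsto e atTop (𝓝 0))
    (h : ∀ j k, c * ‖u j - u k‖ ^ 2 ≤ e j + e k) : CauchySeq u := by
  refine Metric.cauchySeq_iff.2 fun δ hδ => ?_
  have hpos : 0 < c * δ ^ 2 / 2 := by positivity
  obtain ⟨N, hN⟩ := eventually_atTop.1 (he.eventually_lt_const hpos)
  refine ⟨N, fun j hj k hk => ?_⟩
  rw [dist_eq_norm]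
  refine lt_of_pow_lt_pow_left₀ 2 hδ.le ?_
  have := h j k
  have h1 := hN j hj
  have h2 := hN k hk
  exact lt_of_mul_lt_mul_left (by linarith) hc.le

/-- Existence of a minimizer among pairs with prescribed traces. -/
theorem exists_pairEnergy_minimizer {b lam m : ℝ} (hκ : lam ^ 2 * m < 1 / 16) (hb : 1 < b)
    {g h : ℝ × ℝ → ℝ} (hg : Measurable g) (hh : Measurable h) (hne : ∃ p, HasTrace p g)
    (hne' : ∃ q, HasTrace q h) :
    ∃ p q, HasTrace p g ∧ HasTrace q h ∧ ∀ p' q', HasTrace p' g → HasTrace q' h →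
      pairEnergy (lam ^ 2 * m) b lam p q ≤ pairEnergy (lam ^ 2 * m) b lam p' q' := by
  set E := pairEnergy (lam ^ 2 * m) b lam with hE
  set A : Set (H1 × H1) := {w | HasTrace w.1 g ∧ HasTrace w.2 h} with hA
  obtain ⟨p₀, hp₀⟩ := hne
  obtain ⟨q₀, hq₀⟩ := hne'
  obtain ⟨K, hK⟩ := pairEnergy_bddBelow b lam m
  set I : Set ℝ := (fun w : H1 × H1 => E w.1 w.2) '' A with hI
  have hInf : BddBelow I := by
    refine ⟨K, ?_⟩
    rintro _ ⟨w, hw, rfl⟩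
    exact hK _ _ (hw.1.memLp_four_of_measurable hg) (hw.2.memLp_four_of_measurable hh)
  have hIne : I.Nonempty := ⟨_, (p₀, q₀), ⟨hp₀, hq₀⟩, rfl⟩
  obtain ⟨e, -, he, heI⟩ := exists_seq_tendsto_sInf hIne hInf
  choose w hwA hwe using heI
  have hmin : ∀ p q, HasTrace p g → HasTrace q h → sInf I ≤ E p q := fun p q hp hq =>
    csInf_le hInf ⟨(p, q), ⟨hp, hq⟩, rfl⟩
  have h4p : ∀ n, MemLp (H1.val (w n).1) 4 muOmega := fun n =>
    (hwA n).1.memLp_four_of_measurable hg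
  have h4q : ∀ n, MemLp (H1.val (w n).2) 4 muOmega := fun n =>
    (hwA n).2.memLp_four_of_measurable hh
  have hc : 0 < 1 / (32 * b ^ 2) / 4 := by positivity
  have hlim : Tendsto (fun n => (e n - sInf I) / 2) atTop (𝓝 0) := by
    have := (he.sub_const (sInf I)).div_const 2
    simpa using this
  -- Midpoint argument: the midpoint of two members is admissible, so its energy is at least the
  -- infimum, while convexity puts it below the average by a quarter (t(1 − t) at t = 1/2) of the
  -- coercive term.
  have key : ∀ j k, 1 / (32 * b ^ 2) / 4 * ‖(w j).1 - (w k).1‖ ^ 2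
      ≤ (e j - sInf I) / 2 + (e k - sInf I) / 2 ∧
      1 / (32 * b ^ 2) / 4 * ‖(w j).2 - (w k).2‖ ^ 2
      ≤ (e j - sInf I) / 2 + (e k - sInf I) / 2 := by
    intro j k
    have tp := (hwA k).1.sub (hwA j).1 hg
    have tq := (hwA k).2.sub (hwA j).2 hh
    have h1 := pairEnergy_segment_le (lam ^ 2 * m) b lam (h4p k) (h4q k) (h4p j) (h4q j)
      (t := 1 / 2) (by norm_num)
    have h2 := hmin _ _ ((hwA k).1.add_smul tp hg (1 / 2)) ((hwA k).2.add_smul tq hh (1 / 2))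
    have cp := quadEnergy_coercive hκ hb tp
    have cq := quadEnergy_coercive hκ hb tq
    have e1 : pairEnergy (lam ^ 2 * m) b lam (w j).1 (w j).2 = e j := hwe j
    have e2 : pairEnergy (lam ^ 2 * m) b lam (w k).1 (w k).2 = e k := hwe k
    rw [e1, e2] at h1
    have n1 : 0 ≤ 1 / (32 * b ^ 2) * ‖(w j).1 - (w k).1‖ ^ 2 := by positivity
    have n2 : 0 ≤ 1 / (32 * b ^ 2) * ‖(w j).2 - (w k).2‖ ^ 2 := by positivity
    have h3 := h2.trans h1
    constructor <;> linarith
  obtain ⟨p, tp⟩ := cauchySeq_tendsto_of_complete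
    (cauchySeq_of_norm_sub_sq_le hc hlim fun j k => (key j k).1)
  obtain ⟨q, tq⟩ := cauchySeq_tendsto_of_complete
    (cauchySeq_of_norm_sub_sq_le hc hlim fun j k => (key j k).2)
  have hp := HasTrace.of_tendsto (fun n => (hwA n).1) tp
  have hq := HasTrace.of_tendsto (fun n => (hwA n).2) tq
  refine ⟨p, q, hp, hq, fun p' q' hp' hq' => le_trans ?_ (hmin p' q' hp' hq')⟩
  have tquad := (((continuous_quadEnergy (lam ^ 2 * m) b).tendsto p).comp tp).add
    (((continuous_quadEnergy (lam ^ 2 * m) b).tendsto q).comp tq)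
  -- The quadratic part is continuous on H¹, so the quartic terms converge to the infimum minus the
  -- limiting quadratic part.
  have tquartic : Tendsto (fun n => lam ^ 2 / 2 * quarticEnergy (w n).1 (w n).2) atTop
      (𝓝 (sInf I - (quadEnergy (lam ^ 2 * m) b p + quadEnergy (lam ^ 2 * m) b q))) := by
    refine (he.sub tquad).congr fun n => ?_
    rw [← hwe n]
    simp only [hE, pairEnergy, Function.comp_apply]
    ring
  have := quarticEnergy_le_of_tendsto (by positivity) h4p h4q (hp.memLp_four_of_measurable hg)
    (hq.memLp_four_of_measurable hh) tp tq tquartic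
  simp only [hE, pairEnergy]
  linarith

/-! ### Critical points: characterization, uniqueness and symmetry. -/

theorem admissible.hasTrace_zero_zero {B C ε : ℝ} {P : Matrix (Fin 2) (Fin 2) H1}
    (hP : P ∈ admissible B C ε) : HasTrace (P 0 0) fun z => bdryDatum B C ε z 0 0 := hP.2 0 0

theorem admissible.hasTrace_zero_one {B C ε : ℝ} {P : Matrix (Fin 2) (Fin 2) H1}
    (hP : P ∈ admissible B C ε) : HasTrace (P 0 1) fun _ => 0 := by
  have h := hP.2 0 1
  simpa only [bdryDatum_zero_one] using h

theorem admissible.memLp_four {B C ε : ℝ} {P : Matrix (Fin 2) (Fin 2) H1}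
    (hP : P ∈ admissible B C ε) :
    MemLp (H1.val (P 0 0)) 4 muOmega ∧ MemLp (H1.val (P 0 1)) 4 muOmega :=
  ⟨(hasTrace_zero_zero hP).memLp_four_of_measurable (measurable_bdryDatum B C ε 0 0),
    (hasTrace_zero_one hP).memLp_four_of_measurable measurable_const⟩

theorem admissible.add_smul {B C ε : ℝ} {P Φ : Matrix (Fin 2) (Fin 2) H1}
    (hP : P ∈ admissible B C ε) (hΦ : Φ ∈ variations) (t : ℝ) :
    P + t • Φ ∈ admissible B C ε := by
  refine ⟨⟨?_, ?_⟩, fun i j => (hP.2 i j).add_smul (hΦ.2 i j) (measurable_bdryDatum B C ε i j) t⟩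
  · exact hP.1.1.add (hΦ.1.1.smul t)
  · rw [Matrix.trace_fin_two]
    have h1 := hP.1.one_one
    have h2 := hΦ.1.one_one
    change (P 0 0 + t • Φ 0 0) + (P 1 1 + t • Φ 1 1) = 0
    rw [h1, h2]
    module

theorem admissible.sub_mem {B C ε : ℝ} {P Q : Matrix (Fin 2) (Fin 2) H1}
    (hP : P ∈ admissible B C ε) (hQ : Q ∈ admissible B C ε) : Q - P ∈ variations := by
  refine ⟨⟨?_, ?_⟩, fun i j => (hP.2 i j).sub (hQ.2 i j) (measurable_bdryDatum B C ε i j)⟩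
  · exact hQ.1.1.sub hP.1.1
  · rw [Matrix.trace_fin_two]
    have h1 := hP.1.one_one
    have h2 := hQ.1.one_one
    change (Q 0 0 - P 0 0) + (Q 1 1 - P 1 1) = 0
    rw [h1, h2]
    module

theorem admissible.energy_eq {B C ε b lam : ℝ} (hC : C ≠ 0) {P : Matrix (Fin 2) (Fin 2) H1}
    (hP : P ∈ admissible B C ε) :
    energy B C b lam P = pairEnergy (lam ^ 2 * (B ^ 2 / (4 * C ^ 2))) b lam (P 0 0) (P 0 1) := by
  rw [energy_eq_pairEnergy hC hP.1 (memLp_four hP).1 (memLp_four hP).2, mul_div_assoc]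

/-- The energy of a competitor exceeds that of a critical point by a coercive quadratic term. -/
theorem IsCriticalPoint.energy_add_le {B C ε b lam : ℝ} (hC : C ≠ 0)
    {P Q : Matrix (Fin 2) (Fin 2) H1} (hP : IsCriticalPoint B C ε b lam P)
    (hQ : Q ∈ admissible B C ε) :
    energy B C b lam P + (quadEnergy (lam ^ 2 * (B ^ 2 / (4 * C ^ 2))) b (Q 0 0 - P 0 0)
      + quadEnergy (lam ^ 2 * (B ^ 2 / (4 * C ^ 2))) b (Q 0 1 - P 0 1)) ≤ energy B C b lam Q := by
  set G := quadEnergy (lam ^ 2 * (B ^ 2 / (4 * C ^ 2))) b (Q 0 0 - P 0 0)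
      + quadEnergy (lam ^ 2 * (B ^ 2 / (4 * C ^ 2))) b (Q 0 1 - P 0 1) with hG
  have hv := admissible.sub_mem hP.1 hQ
  have hd := hP.2 _ hv
  have hslope := hd.tendsto_slope_zero_right
  have hlim : Tendsto (fun t : ℝ => energy B C b lam Q - energy B C b lam P - (1 - t) * G)
      (𝓝[>] 0) (𝓝 (energy B C b lam Q - energy B C b lam P - (1 - 0) * G)) := by
    refine Tendsto.mono_left (Continuous.tendsto ?_ 0) nhdsWithin_le_nhds
    fun_prop
  have hle : 0 ≤ energy B C b lam Q - energy B C b lam P - (1 - 0) * G := by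
    -- For 0 < t < 1 the difference quotient towards Q is at most E(Q) − E(P) − (1 − t)G; as t → 0⁺
    -- the left side tends to the vanishing first variation.
    refine le_of_tendsto_of_tendsto hslope hlim ?_
    filter_upwards [Ioo_mem_nhdsGT (zero_lt_one' ℝ)] with t ht
    obtain ⟨p4, q4⟩ := admissible.memLp_four hP.1
    obtain ⟨p4', q4'⟩ := admissible.memLp_four hQ
    have seg := pairEnergy_segment_le (lam ^ 2 * (B ^ 2 / (4 * C ^ 2))) b lam p4 q4 p4' q4'
      (t := t) ⟨ht.1.le, ht.2.le⟩
    rw [← hG, ← admissible.energy_eq hC hP.1, ← admissible.energy_eq hC hQ] at seg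
    have e : energy B C b lam (P + t • (Q - P)) = pairEnergy (lam ^ 2 * (B ^ 2 / (4 * C ^ 2))) b lam
        (P 0 0 + t • (Q 0 0 - P 0 0)) (P 0 1 + t • (Q 0 1 - P 0 1)) :=
      admissible.energy_eq hC (admissible.add_smul hP.1 hv t)
    rw [← e] at seg
    simp only [zero_add, zero_smul, add_zero, smul_eq_mul]
    rw [inv_mul_le_iff₀ ht.1]
    linarith
  linarith

/-- Along each line the energy is differentiable and minimal at t = 0, so Fermat's theorem applies.
-/
theorem IsCriticalPoint.of_minimizer {B C ε b lam : ℝ} (hC : C ≠ 0)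
    {P : Matrix (Fin 2) (Fin 2) H1} (hP : P ∈ admissible B C ε)
    (hmin : ∀ Q ∈ admissible B C ε, energy B C b lam P ≤ energy B C b lam Q) :
    IsCriticalPoint B C ε b lam P := by
  refine ⟨hP, fun Φ hΦ => ?_⟩
  have hQ := fun t => admissible.add_smul hP hΦ t
  have e : (fun t : ℝ => energy B C b lam (P + t • Φ)) = fun t : ℝ =>
      quadEnergy (lam ^ 2 * (B ^ 2 / (4 * C ^ 2))) b (P 0 0 + t • Φ 0 0)
      + quadEnergy (lam ^ 2 * (B ^ 2 / (4 * C ^ 2))) b (P 0 1 + t • Φ 0 1)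
      + lam ^ 2 / 2 * quarticEnergy (P 0 0 + t • Φ 0 0) (P 0 1 + t • Φ 0 1) :=
    funext fun t => admissible.energy_eq hC (hQ t)
  have hdiff : Differentiable ℝ fun t : ℝ => energy B C b lam (P + t • Φ) := by
    rw [e]
    exact ((differentiable_quadEnergy_line _ b _ _).add
      (differentiable_quadEnergy_line _ b _ _)).add
      ((differentiable_quarticEnergy_line (admissible.memLp_four hP).1 (admissible.memLp_four hP).2
        ((hΦ.2 0 0).memLp_four_of_measurable measurable_const)
        ((hΦ.2 0 1).memLp_four_of_measurable measurable_const)).const_mul _)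
  have hloc : IsLocalMin (fun t : ℝ => energy B C b lam (P + t • Φ)) 0 :=
    Eventually.of_forall fun t => by
      have h0 : P + (0 : ℝ) • Φ = P := by
        ext1 i j
        change P i j + (0 : ℝ) • Φ i j = P i j
        module
      simp only [h0]
      exact hmin _ (hQ t)
  have := (hdiff 0).hasDerivAt
  rwa [hloc.deriv_eq_zero] at this

theorem eq_of_quadEnergy_le_zero {κ b : ℝ} (hκ : κ < 1 / 16) (hb : 1 < b) {u v u' v' : H1}
    (hu : HasTrace (u' - u) fun _ => 0) (hv : HasTrace (v' - v) fun _ => 0)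
    (h : quadEnergy κ b (u' - u) + quadEnergy κ b (v' - v) ≤ 0) : u' = u ∧ v' = v := by
  have h1 := quadEnergy_coercive hκ hb hu
  have h2 := quadEnergy_coercive hκ hb hv
  have hc : 0 < 1 / (32 * b ^ 2) := by positivity
  have aux : ∀ x y : H1, 1 / (32 * b ^ 2) * ‖x - y‖ ^ 2 ≤ 0 → x = y := fun x y hxy => by
    have h3 : ‖x - y‖ ^ 2 ≤ 0 := by
      by_contra hn
      exact absurd hxy (not_le.2 (mul_pos hc (not_le.1 hn)))
    have h4 : ‖x - y‖ = 0 := pow_eq_zero_iff two_ne_zero |>.1 (le_antisymm h3 (sq_nonneg _))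
    exact eq_of_sub_eq_zero (norm_eq_zero.1 h4)
  have n1 : 0 ≤ 1 / (32 * b ^ 2) * ‖u' - u‖ ^ 2 := by positivity
  have n2 : 0 ≤ 1 / (32 * b ^ 2) * ‖v' - v‖ ^ 2 := by positivity
  exact ⟨aux _ _ (by linarith), aux _ _ (by linarith)⟩

theorem IsCriticalPoint.unique {B C ε b lam : ℝ} (hC : C ≠ 0)
    (hκ : lam ^ 2 * (B ^ 2 / (4 * C ^ 2)) < 1 / 16) (hb : 1 < b)
    {P Q : Matrix (Fin 2) (Fin 2) H1} (hP : IsCriticalPoint B C ε b lam P)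
    (hQ : IsCriticalPoint B C ε b lam Q) : Q = P := by
  -- Adding the two inequalities cancels the energies: the forms at Q − P and P − Q sum to at most
  -- 0, and the second is nonnegative by coercivity.
  have h1 := hP.energy_add_le hC hQ.1
  have h2 := hQ.energy_add_le hC hP.1
  have s1 := admissible.sub_mem hP.1 hQ.1
  have s2 := admissible.sub_mem hQ.1 hP.1
  have c1 := quadEnergy_coercive hκ hb (s2.2 0 0)
  have c2 := quadEnergy_coercive hκ hb (s2.2 0 1)
  have n1 : 0 ≤ 1 / (32 * b ^ 2) * ‖(P - Q) 0 0‖ ^ 2 := by positivity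
  have n2 : 0 ≤ 1 / (32 * b ^ 2) * ‖(P - Q) 0 1‖ ^ 2 := by positivity
  rw [Matrix.sub_apply] at c1 c2 n1 n2
  obtain ⟨e1, e2⟩ := eq_of_quadEnergy_le_zero hκ hb (u := P 0 0) (v := P 0 1) (u' := Q 0 0)
    (v' := Q 0 1) (s1.2 0 0) (s1.2 0 1) (by linarith)
  exact hQ.1.1.ext hP.1.1 e1 e2

theorem pairEnergy_neg_right (κ b lam : ℝ) (p q : H1) :
    pairEnergy κ b lam p (-q) = pairEnergy κ b lam p q := by
  have h1 : quadEnergy κ b (-q) = quadEnergy κ b q := by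
    have e0 : ‖H1.val (-q)‖ = ‖H1.val q‖ := norm_neg (H1.val q)
    have e1 : ‖H1.dx (-q)‖ = ‖H1.dx q‖ := norm_neg (H1.dx q)
    have e2 : ‖H1.dy (-q)‖ = ‖H1.dy q‖ := norm_neg (H1.dy q)
    rw [quadEnergy, e0, e1, e2, quadEnergy]
  have h2 : quarticEnergy p (-q) = quarticEnergy p q := by
    refine integral_congr_ae ?_
    filter_upwards [Lp.coeFn_neg (H1.val q)] with z hz
    have hz' : H1.val (-q) z = -H1.val q z := hz
    rw [hz', neg_sq]
  rw [pairEnergy, h1, h2, pairEnergy]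

theorem exists_isCriticalPoint {B C ε b lam : ℝ} (hC : C ≠ 0) (hε : 0 < ε) (hε' : ε < 1 / 2)
    (hκ : lam ^ 2 * (B ^ 2 / (4 * C ^ 2)) < 1 / 16) (hb : 1 < b) :
    ∃ P, IsCriticalPoint B C ε b lam P ∧ P 0 1 = 0 := by
  obtain ⟨p, q, hp, hq, hmin⟩ := exists_pairEnergy_minimizer hκ hb (measurable_bdryDatum B C ε 0 0)
    measurable_const (exists_hasTrace_bdryDatum B C hε hε') ⟨0, hasTrace_zero⟩
  have crit : ∀ q', HasTrace q' (fun _ => 0) →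
      pairEnergy (lam ^ 2 * (B ^ 2 / (4 * C ^ 2))) b lam p q'
        = pairEnergy (lam ^ 2 * (B ^ 2 / (4 * C ^ 2))) b lam p q →
      IsCriticalPoint B C ε b lam (s0Matrix p q') := by
    intro q' hq' he
    have hadm : s0Matrix p q' ∈ admissible B C ε := s0Matrix_mem_admissible hp hq'
    refine IsCriticalPoint.of_minimizer hC hadm fun Q hQ => ?_
    rw [admissible.energy_eq hC hadm, admissible.energy_eq hC hQ]
    exact he.le.trans (hmin _ _ (admissible.hasTrace_zero_zero hQ) (admissible.hasTrace_zero_one hQ))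
  have h1 := crit q hq rfl
  -- Reflecting q gives another minimizer with the same traces, hence another critical point.
  have h2 := crit (-q) hq.neg (pairEnergy_neg_right _ _ _ _ _)
  refine ⟨_, h1, ?_⟩
  have e : -q = q := congrFun (congrFun (h1.unique hC hκ hb h2) 0) 1
  have e2 : q = (1 / 2 : ℝ) • (q - -q) := by module
  change q = 0
  rw [e2, e, sub_self]
  module

end RLdG

theorem mainTheorem2 (B C S ε : ℝ) (hB : 0 < B) (hC : 0 < C) (hε : 0 < ε) (hε' : ε < 1 / 2)
    (b : ℝ) (hb : max 1 (S * B ^ 2 / C ^ 2) < b)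
    (lam : ℝ) (hlam : 0 ≤ lam) (hS : S = 4 * lam ^ 2 * b) :
    ∃ P : Matrix (Fin 2) (Fin 2) RLdG.H1,
      RLdG.IsCriticalPoint B C ε b lam P ∧ P 0 1 = 0 ∧
        ∀ Q : Matrix (Fin 2) (Fin 2) RLdG.H1, RLdG.IsCriticalPoint B C ε b lam Q → Q = P := by
  obtain ⟨hb1, hb2⟩ := max_lt_iff.1 hb
  -- With S = 4λ²b one has SB²/C² = 16κb, so b > SB²/C² is κ < 1/16 after division by b > 0.
  have hκ : lam ^ 2 * (B ^ 2 / (4 * C ^ 2)) < 1 / 16 := by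
    have e : S * B ^ 2 / C ^ 2 = 16 * (lam ^ 2 * (B ^ 2 / (4 * C ^ 2))) * b := by
      rw [hS]
      field_simp
      ring
    rw [e] at hb2
    nlinarith
  obtain ⟨P, hP, hP0⟩ := RLdG.exists_isCriticalPoint hC.ne' hε hε' hκ hb1
  exact ⟨P, hP, hP0, fun Q hQ => hP.unique hC.ne' hκ hb1 hQ⟩
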